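/- Let $K$ be a field, complete with respect to a nontrivial non-Archimedean absolute value $|\cdot|$, and let $L$ be any algebraically closed complete non-Archimedean extension of $K$ (for example $\mathbb{C}_p$ when $K=\mathbb{Q}_p$). A disc is an open or closed ball of positive radius, or the whole field. For a power series $f(x)=x_0+\lambda(x-x_0)+\sum_{i\ge 2}a_i(x-x_0)^i$ over $K$ with $|\lambda|=1$, $\lambda$ not a root of unity, let $g(x)=(x-x_0)+\cdots\in K[[x-x_0]]$ be the formal solution of $g\circ f=\lambda g$. The linearization disc $\Delta_f$ is the largest disc in $L$ about $x_0$ on which $f$ and $g$ converge, $g\circ f=\lambda g$ holds, and $g$ is one-to-one (if such a disc exists); the linearization disc in $K$ is $\Delta=\Delta_f\cap K$. (1) Let $f$ be holomorphic on a disc $U\subseteq K$ about the fixed point $x_0$, with a linearization disc $\Delta\subseteq U$ in $K$, and let $S=\{x\in K:|x-x_0|=r\}$, $r>0$, be a non-empty sphere with $S\subseteq\Delta$. Then $f(S)\subseteq S$, and the following are equivalent: (i) $f:S\to S$ is ergodic for some $f$-invariant Borel probability measure on $S$ that is positive on non-empty open sets; (ii) such measures exist and $f$ is ergodic for each of them;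 (iii) for some odd prime $p$ there is an isomorphism of topological fields $K\cong\mathbb{Q}_p$ that maps $\lambda$ to an element of $\mathbb{Z}_p$ whose residue class generates $(\mathbb{Z}/p^2\mathbb{Z})^*$. (2) If $K$ is a proper finite extension of $\mathbb{Q}_p$ ($p$ any prime), or a locally compact field of positive characteristic (with nontrivial non-Archimedean absolute value), and $\lambda\in K$, $|\lambda|=1$, then $x\mapsto\lambda x$ has no dense forward orbit on any sphere of positive radius about $0$ in $K$. (3) Let $p$ be an odd prime, let $f(x)=x_0+\lambda(x-x_0)+\sum_{i\ge2}a_i(x-x_0)^i$ be a power series over $\mathbb{Q}_p$ with $a=\sup_{i\ge 2}|a_i|^{1/(i-1)}<\infty$, and let $\lambda\in\mathbb{Z}_p$ generate $(\mathbb{Z}/p^2\mathbb{Z})^*$. Then $f$ has a linearization disc, and its linearization disc $\Delta$ in $\mathbb{Q}_p$ has radius $1/a$ as a disc in $\mathbb{Q}_p$, that is, up to rounding to the value group: if $a>0$ and $\rho$ is the largest integer power of $p$ with $\rho\le 1/a$ (so $\rho=1/a$ if $1/a$ is a power of $p$), then $\Delta$ is either the open or the closed disc of radius $\rho$ about $x_0$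 in $\mathbb{Q}_p$; if $a=0$, then $\Delta=\mathbb{Q}_p$. -/

import Mathlib

open MeasureTheory

noncomputable section

namespace NonArch

/-! ### Discs and power series -/

/-- `U` is a disc about `x₀`: an open or a closed ball of positive radius, or the whole space
(the disc of infinite radius). In an ultrametric space each point of a disc is a centre of it. -/
def IsDiscAbout {X : Type*} [PseudoMetricSpace X] (x₀ : X) (U : Set X) : Prop :=
  U = Set.univ ∨ ∃ r : ℝ, 0 < r ∧ (U = Metric.ball x₀ r ∨ U = Metric.closedBall x₀ r)

section Series

variable {K : Type*} [NontriviallyNormedField K] {L : Type*} [NontriviallyNormedField L]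
  [NormedAlgebra K L]

/-- The `n`-th term of the power series `F` over `K` at the point `y` of the extension `L`. -/
def term (F : PowerSeries K) (y : L) (n : ℕ) : L :=
  algebraMap K L (PowerSeries.coeff n F) * y ^ n

/-- `F` converges at `y`. -/
def ConvergesAt (F : PowerSeries K) (y : L) : Prop := Summable (term F y)

/-- The sum of `F` at `y` (meaningful where `F` converges). -/
def value (F : PowerSeries K) (y : L) : L := ∑' n, term F y n

/-- `f` is holomorphic on the disc `U` about its fixed point `x₀`, where the power series `F` is the
expansion of `f - x₀` about `x₀`, that is `f x = x₀ + ∑ aᵢ (x - x₀) ^ i` for all `x` in `U`. -/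
structure HolomorphicWithFixedPoint (f : K → K) (x₀ : K) (F : PowerSeries K) (U : Set K) :
    Prop where
  disc : IsDiscAbout x₀ U
  fixed : f x₀ = x₀
  expansion : ∀ x ∈ U,
    HasSum (fun n : ℕ => PowerSeries.coeff n F * (x - x₀) ^ n) (f x - x₀)

/-! ### Conjugacy and linearization discs

Below `F = λ X + a₂ X² + …` is the expansion of `f - f(x₀)` about the fixed point `x₀`, so the
multiplier `λ` is the coefficient of `F` at `X`, and `G` is the expansion of the conjugacy function
`g` about `x₀`. -/

/-- `G = X + …` is a formal solution of the Schröder equation `G ∘ F = λ G`. -/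
structure IsFormalConjugacy (F G : PowerSeries K) : Prop where
  coeff_zero : PowerSeries.coeff 0 G = 0
  coeff_one : PowerSeries.coeff 1 G = 1
  schroeder : PowerSeries.subst F G = PowerSeries.C (PowerSeries.coeff 1 F) * G

/-- On the subset `U` of `L`, the map `f` given by `F` about `x₀` and the conjugacy function given
by `G` converge, the Schröder equation `g (f x) = λ g x` holds at each point, and `g` is
one-to-one. -/
structure LinearizesOn (F G : PowerSeries K) (x₀ : L) (U : Set L) : Prop where
  conv_f : ∀ x ∈ U, ConvergesAt F (x - x₀)
  conv_g : ∀ x ∈ U, ConvergesAt G (x - x₀)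
  conv_comp : ∀ x ∈ U, ConvergesAt G (value F (x - x₀))
  schroeder : ∀ x ∈ U, value G (value F (x - x₀)) =
    algebraMap K L (PowerSeries.coeff 1 F) * value G (x - x₀)
  injOn : Set.InjOn (fun x => value G (x - x₀)) U

/-- `Δ ⊆ L` is the linearization disc, over the extension `L` of `K`, of the map
`f = x₀ + F(x - x₀)` about its indifferent, non-resonant fixed point `x₀ ∈ K`: it is the largest
disc about `x₀` in `L` on which `f` and the conjugacy function `g` converge, the Schröder equation
holds, and `g` is one-to-one. -/
structure IsLinearizationDisc (F : PowerSeries K) (x₀ : K) (Δ : Set L) : Prop where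
  coeff_zero : PowerSeries.coeff 0 F = 0
  indifferent : ‖PowerSeries.coeff 1 F‖ = 1
  nonresonant : ∀ n : ℕ, 1 ≤ n → PowerSeries.coeff 1 F ^ n ≠ 1
  greatest : ∃ G : PowerSeries K, IsFormalConjugacy F G ∧
    IsGreatest {U : Set L | IsDiscAbout (algebraMap K L x₀) U ∧
      LinearizesOn F G (algebraMap K L x₀) U} Δ

/-- The linearization disc in `K` that corresponds to the linearization disc `Δ` over `L`, namely
`Δ ∩ K`. -/
def restrictDisc (K : Type*) [NontriviallyNormedField K] {L : Type*} [NontriviallyNormedField L]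
    [NormedAlgebra K L] (Δ : Set L) : Set K :=
  algebraMap K L ⁻¹' Δ

/-- The set of the numbers `|aᵢ| ^ (1 / (i - 1))`, `i ≥ 2`. -/
def growthSet (F : PowerSeries K) : Set ℝ :=
  {t | ∃ i : ℕ, 2 ≤ i ∧ t = ‖PowerSeries.coeff i F‖ ^ (1 / ((i : ℝ) - 1))}

/-- `a = sup_{i ≥ 2} |aᵢ| ^ (1 / (i - 1))` (for a series `F` whose growth set is bounded). -/
def growth (F : PowerSeries K) : ℝ := sSup (growthSet F)

end Series

/-! ### Dynamics -/

/-- `f` is transitive on `S`: the set `S` is invariant, and some point of `S` has a forward orbit that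
is dense in `S`. -/
def IsTransitiveOn {X : Type*} [TopologicalSpace X] (f : X → X) (S : Set X) : Prop :=
  Set.MapsTo f S S ∧ ∃ x ∈ S, S ⊆ closure (Set.range fun n : ℕ => f^[n] x)

/-- `μ` is a `T`-invariant Borel probability measure that is positive on non-empty open sets. -/
structure IsInvariantFullMeasure {X : Type*} [TopologicalSpace X] [MeasurableSpace X]
    (T : X → X) (μ : Measure X) : Prop where
  prob : IsProbabilityMeasure μ
  invariant : MeasurePreserving T μ μ
  pos : μ.IsOpenPosMeasure

/-- `T` is ergodic for some invariant Borel probability measure that is positive on non-empty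
open sets. -/
def IsErgodicForSome {X : Type*} [TopologicalSpace X] [MeasurableSpace X] (T : X → X) : Prop :=
  ∃ μ : Measure X, IsInvariantFullMeasure T μ ∧ Ergodic T μ

/-- There are invariant Borel probability measures that are positive on non-empty open sets, and
`T` is ergodic for every one of them. -/
def IsErgodicForAll {X : Type*} [TopologicalSpace X] [MeasurableSpace X] (T : X → X) : Prop :=
  (∃ μ : Measure X, IsInvariantFullMeasure T μ) ∧
    ∀ μ : Measure X, IsInvariantFullMeasure T μ → Ergodic T μ

/-! ### The multiplier -/

/-- The `p`-adic number `x` is an integer whose residue class generates `(ℤ/p²ℤ)ˣ`. -/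
def GeneratesUnitsModSq (p : ℕ) [Fact p.Prime] (x : ℚ_[p]) : Prop :=
  ∃ (z : ℤ_[p]) (u : (ZMod (p ^ 2))ˣ), (z : ℚ_[p]) = x ∧
    PadicInt.toZModPow 2 z = (u : ZMod (p ^ 2)) ∧ Subgroup.zpowers u = ⊤

/-- For some odd prime `p`, the field `K` is isomorphic, as a topological field, to `ℚ_p`, and the
isomorphism maps `lam` to a `p`-adic integer that generates `(ℤ/p²ℤ)ˣ`. -/
def IsPadicWithGenerator {K : Type*} [NontriviallyNormedField K] (lam : K) : Prop :=
  ∃ (p : ℕ) (_ : Fact p.Prime), p ≠ 2 ∧ ∃ e : K ≃+* ℚ_[p], Continuous e ∧ Continuous e.symm ∧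
    GeneratesUnitsModSq p (e lam)

end NonArch

end

noncomputable section

namespace NonArch

/-! ### Fields in which the powers of a unit are dense in the unit sphere -/

section Ultrametric

variable {K : Type*} [NormedField K] [IsUltrametricDist K]

/-! The dynamics reduces to multiplication by $\lambda$ on the unit sphere of $K$, and everything in
(1) and (2) turns on one property, `HasDensePowers`: the powers of $\lambda$ are dense in that
sphere.

Reduction. Over an algebraically closed complete field, a power series that is one-to-one on a
closed ball has a linear term that strictly dominates every higher term there; otherwise the series
divided by its variable would have a zero in the ball (`exists_zero_of_norm_le`,
`norm_coeff_mul_pow_lt_one`). Inside the linearization disc this applies to $g$, and also to $f$,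
which is one-to-one because $\lambda g = g\circ f$ is. Hence $g$ is an isometry on the $K$-points,
$f$ preserves spheres, and a contraction argument shows that $g$ is onto over $K$. After scaling,
$g$ conjugates $f$ on $S$ to the rotation by $\lambda$ (`exists_homeomorph_unitSphere`).

From ergodicity to $\mathbb{Q}_p$. An ergodic rotation has dense integer powers, and Poincaré
recurrence replaces them by natural powers (`hasDensePowers_of_ergodic`). Density makes the
principal units topologically generated by a single $1+x$. Then $x$ is a uniformizer and the residue
field is a prime field. Comparing powers of $1+x$ with $1+x^2$ or $1+x^3$ modulo small powers of $x$
excludes residue characteristic 2 and forces $p$ itself to be a uniformizer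
(`HasDensePowers.exists_prime`). So the natural numbers are dense in the unit ball, which identifies
a complete $K$ with $\mathbb{Q}_p$ (`exists_padic_ringEquiv`); it also contradicts the situations of
(2).

From a generator to ergodicity. Lifting the exponent gives density of powers
(`GeneratesUnitsModSq.hasDensePowers`). On the compact unit sphere every invariant probability
measure is then invariant under all rotations, and density of powers gives ergodicity.

The radius in (3). The coefficients $b_n$ of $g$ satisfy $|b_{n+1}|\prod_{j\le n}|\lambda^j-1|\le
a^n$. For a generator the product is $|p|^m|m!|$ with $m=\lfloor n/(p-1)\rfloor$, which is at least
$|p|^{3n/4}$ for odd $p$. Hence $g$ converges and is one-to-one on a closed ball of radius $r$ as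
soon as $ar\le 1/p$, while dominance of the linear term of $f$ gives $ar\le 1$ on the disc. Since
the value group is $p^{\mathbb{Z}}$, these two bounds leave only the open and the closed disc of
radius $\rho$. -/

theorem norm_add_le_of_le {a b : K} {δ : ℝ} (ha : ‖a‖ ≤ δ) (hb : ‖b‖ ≤ δ) : ‖a + b‖ ≤ δ :=
  (IsUltrametricDist.norm_add_le_max a b).trans (max_le ha hb)

theorem norm_sub_le_of_le {a b : K} {δ : ℝ} (ha : ‖a‖ ≤ δ) (hb : ‖b‖ ≤ δ) : ‖a - b‖ ≤ δ := by
  rw [sub_eq_add_neg]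
  exact norm_add_le_of_le ha (by rwa [norm_neg])

theorem norm_add_lt_of_lt {a b : K} {δ : ℝ} (ha : ‖a‖ < δ) (hb : ‖b‖ < δ) : ‖a + b‖ < δ :=
  (IsUltrametricDist.norm_add_le_max a b).trans_lt (max_lt ha hb)

theorem norm_sub_lt_of_lt {a b : K} {δ : ℝ} (ha : ‖a‖ < δ) (hb : ‖b‖ < δ) : ‖a - b‖ < δ := by
  rw [sub_eq_add_neg]
  exact norm_add_lt_of_lt ha (by rwa [norm_neg])

theorem norm_eq_of_norm_sub_lt {a b : K} (h : ‖a - b‖ < ‖b‖) : ‖a‖ = ‖b‖ := by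
  apply le_antisymm
  · simpa using norm_add_le_of_le h.le (le_refl ‖b‖)
  · by_contra! hlt
    have := norm_sub_lt_of_lt hlt h
    simp at this

theorem norm_eq_one_of_norm_sub_one_lt {a : K} (h : ‖a - 1‖ < 1) : ‖a‖ = 1 := by
  simpa using norm_eq_of_norm_sub_lt (b := (1 : K)) (by simpa using h)

theorem norm_pow_sub_one_le {a : K} (ha : ‖a‖ ≤ 1) (n : ℕ) : ‖a ^ n - 1‖ ≤ ‖a - 1‖ := by
  induction n with
  | zero => simp
  | succ n ih =>
    have : a ^ (n + 1) - 1 = a * (a ^ n - 1) + (a - 1) := by ring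
    rw [this]
    refine norm_add_le_of_le ?_ le_rfl
    rw [norm_mul]
    exact (mul_le_of_le_one_left (norm_nonneg _) ha).trans ih

theorem norm_natCast_le_one' (n : ℕ) : ‖(n : K)‖ ≤ 1 :=
  IsUltrametricDist.norm_natCast_le_one K n

theorem norm_intCast_le_one' (n : ℤ) : ‖(n : K)‖ ≤ 1 :=
  IsUltrametricDist.norm_intCast_le_one K n

theorem exists_prime_norm_lt_one {n : ℕ} (hn : n ≠ 0) (h : ‖(n : K)‖ < 1) :
    ∃ p : ℕ, p.Prime ∧ ‖(p : K)‖ < 1 := by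
  induction n using Nat.strong_induction_on with
  | _ n ih =>
    have h1 : n ≠ 1 := by rintro rfl; simp at h
    have hp := Nat.minFac_prime h1
    by_cases hm : ‖(n.minFac : K)‖ < 1
    · exact ⟨_, hp, hm⟩
    · refine ih (n / n.minFac) (Nat.div_lt_self (Nat.pos_of_ne_zero hn) hp.one_lt)
        (Nat.div_ne_zero_iff.2 ⟨hp.ne_zero, Nat.minFac_le (Nat.pos_of_ne_zero hn)⟩) ?_
      have h2 : (n : K) = n.minFac * (n / n.minFac : ℕ) := by
        rw [← Nat.cast_mul, Nat.mul_div_cancel' n.minFac_dvd]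
      rw [h2, norm_mul] at h
      have h3 : ‖(n.minFac : K)‖ = 1 := le_antisymm (norm_natCast_le_one' _) (not_lt.1 hm)
      simpa [h3] using h

theorem dvd_of_norm_natCast_lt_one {p m : ℕ} (hp : p.Prime) (hpn : ‖(p : K)‖ < 1)
    (hm : ‖(m : K)‖ < 1) : p ∣ m := by
  by_contra hd
  have hc : IsCoprime (p : ℤ) m := Nat.isCoprime_iff_coprime.2 ((hp.coprime_iff_not_dvd).2 hd)
  obtain ⟨a, b, hab⟩ := hc
  have h1 : (a : K) * p + b * m = 1 := by exact_mod_cast congrArg (Int.cast : ℤ → K) hab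
  have h2 : ‖(a : K) * p + b * m‖ < 1 := by
    apply norm_add_lt_of_lt <;> rw [norm_mul]
    · exact (mul_le_of_le_one_left (norm_nonneg _) (norm_intCast_le_one' _)).trans_lt hpn
    · exact (mul_le_of_le_one_left (norm_nonneg _) (norm_intCast_le_one' _)).trans_lt hm
  rw [h1] at h2
  simp at h2

theorem norm_natCast_le_of_dvd {p m : ℕ} (h : p ∣ m) : ‖(m : K)‖ ≤ ‖(p : K)‖ := by
  obtain ⟨k, rfl⟩ := h
  rw [Nat.cast_mul, norm_mul]
  exact mul_le_of_le_one_right (norm_nonneg _) (norm_natCast_le_one' _)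

/-- A third-order binomial expansion with an integral remainder. It involves no division, so it
holds in every characteristic; all computations with powers of principal units rest on it. -/
theorem one_add_pow_eq {x : K} (hx : ‖x‖ ≤ 1) (j : ℕ) :
    ∃ c : K, ‖c‖ ≤ 1 ∧ (1 + x) ^ j = 1 + j * x + (j.choose 2 : ℕ) * x ^ 2 + c * x ^ 3 := by
  induction j with
  | zero => exact ⟨0, by simp, by simp⟩
  | succ j ih =>
    obtain ⟨c, hc, h⟩ := ih
    refine ⟨c + (j.choose 2 : ℕ) + c * x, ?_, ?_⟩
    · refine norm_add_le_of_le (norm_add_le_of_le hc (norm_natCast_le_one' _)) ?_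
      rw [norm_mul]
      exact mul_le_one₀ hc (norm_nonneg _) hx
    · rw [pow_succ, h, Nat.choose_succ_succ' j 1]
      push_cast
      simp only [Nat.choose_one_right]
      ring

end Ultrametric

/-- The forward orbit of `1` under multiplication by `lam` is dense in the unit sphere. -/
def HasDensePowers {K : Type*} [NormedField K] (lam : K) : Prop :=
  ∀ u : K, ‖u‖ = 1 → ∀ ε > 0, ∃ n : ℕ, ‖lam ^ n - u‖ < ε

section DensePowers

variable {K : Type*} [NontriviallyNormedField K] [IsUltrametricDist K] {lam : K}

/-- The generator is $\lambda^m$ with $m$ the least positive exponent for which $\lambda^m$ is a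
principal unit. A power of $\lambda$ close to a principal unit is itself principal, so its exponent
is a multiple of $m$. -/
theorem HasDensePowers.exists_principal_generator (h : HasDensePowers lam) (hlam : ‖lam‖ = 1) :
    ∃ l : K, ‖l - 1‖ < 1 ∧ ∀ u : K, ‖u - 1‖ < 1 → ∀ ε > 0, ∃ n : ℕ, ‖l ^ n - u‖ < ε := by
  classical
  have hlam0 : lam ≠ 0 := by rintro rfl; simp at hlam
  have hex : ∃ m : ℕ, 0 < m ∧ ‖lam ^ m - 1‖ < 1 := by
    -- Approximating $\lambda^{-1}$ rather than $1$ ensures that the resulting exponent $n+1$ is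
    -- positive.
    obtain ⟨n, hn⟩ := h lam⁻¹ (by simp [hlam]) 1 one_pos
    refine ⟨n + 1, n.succ_pos, ?_⟩
    have : lam ^ (n + 1) - 1 = (lam ^ n - lam⁻¹) * lam := by
      rw [sub_mul, inv_mul_cancel₀ hlam0, pow_succ]
    rwa [this, norm_mul, hlam, mul_one]
  set m := Nat.find hex with hm
  obtain ⟨hm0, hm1⟩ := Nat.find_spec hex
  have hdvd : ∀ n, ‖lam ^ n - 1‖ < 1 → m ∣ n := by
    intro n hn
    by_contra hd
    have hr : 0 < n % m := Nat.pos_of_ne_zero fun h0 => hd (Nat.dvd_of_mod_eq_zero h0)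
    refine Nat.find_min hex (Nat.mod_lt n hm0) ⟨hr, ?_⟩
    have e : lam ^ (n % m) - 1 = (lam ^ n - 1) - lam ^ (n % m) * ((lam ^ m) ^ (n / m) - 1) := by
      have : lam ^ n = lam ^ (n % m) * (lam ^ m) ^ (n / m) := by
        rw [← pow_mul, ← pow_add, Nat.mod_add_div]
      rw [this]; ring
    rw [e]
    refine norm_sub_lt_of_lt hn ?_
    rw [norm_mul, norm_pow, hlam, one_pow, one_mul]
    exact (norm_pow_sub_one_le (by simp [hlam]) _).trans_lt hm1
  refine ⟨lam ^ m, hm1, fun u hu ε hε => ?_⟩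
  -- The cap at 1 keeps $\lambda^n$ among the principal units, which makes $m$ divide $n$.
  obtain ⟨n, hn⟩ := h u (norm_eq_one_of_norm_sub_one_lt hu) (min ε 1) (lt_min hε one_pos)
  obtain ⟨k, rfl⟩ := hdvd n (by
    have : lam ^ n - 1 = (lam ^ n - u) + (u - 1) := by ring
    rw [this]
    exact norm_add_lt_of_lt (hn.trans_le (min_le_right _ _)) hu)
  exact ⟨k, by rw [← pow_mul]; exact hn.trans_le (min_le_left _ _)⟩

/-- A uniformizer whose translate by `1` topologically generates the principal units. -/
structure IsPrincipalGenerator (x : K) : Prop where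
  ne_zero : x ≠ 0
  norm_lt : ‖x‖ < 1
  dense : ∀ y : K, ‖y‖ < 1 → ∀ ε > 0, ∃ n : ℕ, ‖(1 + x) ^ n - (1 + y)‖ < ε

namespace IsPrincipalGenerator

variable {x : K}

/-- All powers of $1+x$ stay within $|x|$ of 1, so they cannot approach $1+y$ when $|y|>|x|$. -/
theorem norm_le (h : IsPrincipalGenerator x) {y : K} (hy : ‖y‖ < 1) : ‖y‖ ≤ ‖x‖ := by
  by_contra! hlt
  obtain ⟨n, hn⟩ := h.dense y hy ‖y‖ ((norm_nonneg _).trans_lt hlt)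
  have h1 : ‖(1 + x) ^ n - 1‖ ≤ ‖x‖ := by
    have := norm_pow_sub_one_le (a := 1 + x)
      (norm_add_le_of_le (by simp) h.norm_lt.le) n
    simpa using this
  have h2 : y = ((1 + x) ^ n - 1) - ((1 + x) ^ n - (1 + y)) := by ring
  have h3 : ‖y‖ < ‖y‖ := by
    conv_lhs => rw [h2]
    exact norm_sub_lt_of_lt (h1.trans_lt hlt) hn
  exact lt_irrefl _ h3

theorem norm_le_mul (h : IsPrincipalGenerator x) {y z : K} (hy : ‖y‖ < ‖z‖) :
    ‖y‖ ≤ ‖x‖ * ‖z‖ := by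
  have hz : 0 < ‖z‖ := (norm_nonneg _).trans_lt hy
  have := h.norm_le (y := y / z) (by rwa [norm_div, div_lt_one hz])
  rwa [norm_div, div_le_iff₀ hz] at this

/-- Approximate $1+xy$ by $(1+x)^j\equiv 1+jx$ modulo $x^2$ and divide by $x$: the residue class of
$y$ is that of $j$. -/
theorem exists_natCast (h : IsPrincipalGenerator x) {y : K} (hy : ‖y‖ ≤ 1) :
    ∃ n : ℕ, ‖y - n‖ ≤ ‖x‖ := by
  have hx0 : 0 < ‖x‖ := norm_pos_iff.2 h.ne_zero
  obtain ⟨j, hj⟩ := h.dense (x * y)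
    (by rw [norm_mul]; exact (mul_le_of_le_one_right hx0.le hy).trans_lt h.norm_lt) (‖x‖ ^ 2)
    (by positivity)
  obtain ⟨c, hc, hcj⟩ := one_add_pow_eq h.norm_lt.le j
  refine ⟨j, ?_⟩
  have e : x * (y - j) = ((j.choose 2 : ℕ) + c * x) * x ^ 2
      - ((1 + x) ^ j - (1 + x * y)) := by
    rw [hcj]; ring
  have h1 : ‖x * (y - j)‖ ≤ ‖x‖ ^ 2 := by
    rw [e]
    refine norm_sub_le_of_le ?_ hj.le
    rw [norm_mul, norm_pow]
    refine mul_le_of_le_one_left (by positivity) (norm_add_le_of_le (norm_natCast_le_one' _) ?_)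
    rw [norm_mul]
    exact mul_le_one₀ hc (norm_nonneg _) h.norm_lt.le
  rw [norm_mul, pow_two] at h1
  exact le_of_mul_le_mul_left h1 hx0

/-- The class of $-1$ is represented by a natural number $j$, so the positive integer $j+1$ is not a
unit. -/
theorem exists_prime (h : IsPrincipalGenerator x) : ∃ p : ℕ, p.Prime ∧ ‖(p : K)‖ < 1 := by
  obtain ⟨j, hj⟩ := h.exists_natCast (y := -1) (by simp)
  refine exists_prime_norm_lt_one (n := j + 1) j.succ_ne_zero ?_
  have : ((j + 1 : ℕ) : K) = -(-1 - (j : K)) := by push_cast; ring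
  rw [this, norm_neg]
  exact hj.trans_lt h.norm_lt

/-- If $|p|\le|x|^2$, let $(1+x)^j\equiv 1+x^2$ modulo $x^3$, that is, $j+(\binom j2-1)x\equiv 0$
modulo $x^2$. First $p\mid j$, so $j$ vanishes modulo $x^2$ and $\binom j2\equiv 1$ modulo $x$. But
$p$ odd and $p\mid j$ give $p\mid\binom j2$, a contradiction. -/
theorem norm_prime_of_ne_two (h : IsPrincipalGenerator x) {p : ℕ} (hp : p.Prime) (h2 : p ≠ 2)
    (hpn : ‖(p : K)‖ < 1) : ‖(p : K)‖ = ‖x‖ := by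
  have hx0 : 0 < ‖x‖ := norm_pos_iff.2 h.ne_zero
  have hx1 := h.norm_lt
  refine (h.norm_le hpn).eq_of_not_lt fun hlt => ?_
  have hp2 := h.norm_le_mul hlt
  obtain ⟨j, hj⟩ := h.dense (x ^ 2) (by rw [norm_pow]; exact pow_lt_one₀ hx0.le hx1 two_ne_zero)
    (‖x‖ ^ 3) (by positivity)
  obtain ⟨c, hc, hcj⟩ := one_add_pow_eq hx1.le j
  set C : K := ((j.choose 2 : ℕ) : K) with hC
  have h1 : ‖(j : K) + (C - 1) * x‖ ≤ ‖x‖ * ‖x‖ := by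
    have e : x * (j + (C - 1) * x) = ((1 + x) ^ j - (1 + x ^ 2)) - c * x ^ 3 := by
      rw [hcj]; ring
    have : ‖x * (j + (C - 1) * x)‖ ≤ ‖x‖ ^ 3 := by
      rw [e]
      refine norm_sub_le_of_le hj.le ?_
      rw [norm_mul, norm_pow]
      exact mul_le_of_le_one_left (by positivity) hc
    rw [norm_mul] at this
    refine le_of_mul_le_mul_left (this.trans_eq ?_) hx0
    ring
  have hC1 : ‖C - 1‖ ≤ 1 := norm_sub_le_of_le (norm_natCast_le_one' _) (by simp)
  have h3 : ‖(j : K)‖ < 1 := by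
    have e : (j : K) = (j + (C - 1) * x) - (C - 1) * x := by ring
    rw [e]
    refine norm_sub_lt_of_lt (h1.trans_lt (by nlinarith)) ?_
    rw [norm_mul]
    exact (mul_le_of_le_one_left hx0.le hC1).trans_lt hx1
  have hdvd := dvd_of_norm_natCast_lt_one hp hpn h3
  have h4 : ‖(j : K)‖ ≤ ‖x‖ * ‖x‖ := (norm_natCast_le_of_dvd hdvd).trans hp2
  have h5 : ‖C - 1‖ < 1 := by
    have : ‖(C - 1) * x‖ ≤ ‖x‖ * ‖x‖ := by
      have e : (C - 1) * x = (j + (C - 1) * x) - j := by ring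
      rw [e]
      exact norm_sub_le_of_le h1 h4
    rw [norm_mul] at this
    exact (le_of_mul_le_mul_right this hx0).trans_lt hx1
  have h6 : p ∣ j.choose 2 := by
    have e : p ∣ 2 * j.choose 2 := by
      rw [Nat.choose_two_right, Nat.mul_div_cancel' (Nat.even_mul_pred_self j).two_dvd]
      exact hdvd.mul_right _
    refine ((Nat.Prime.dvd_mul hp).1 e).resolve_left fun h => h2 ?_
    exact (Nat.prime_dvd_prime_iff_eq hp Nat.prime_two).1 h
  have h7 : ‖C‖ < 1 := (norm_natCast_le_of_dvd h6).trans_lt hpn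
  have h8 := norm_sub_lt_of_lt h7 h5
  simp at h8

/-- In residue characteristic 2 the powers of $1+x$ repeat too early to reach all principal units
modulo $x^3$ (when 2 is a uniformizer) or modulo $x^4$ (otherwise, including $2=0$). -/
theorem one_le_norm_two (h : IsPrincipalGenerator x) : 1 ≤ ‖(2 : K)‖ := by
  by_contra! h2
  have hx0 : 0 < ‖x‖ := norm_pos_iff.2 h.ne_zero
  have hx1 := h.norm_lt
  have h2x : ‖(2 : K)‖ ≤ ‖x‖ := h.norm_le h2
  have hl : ‖1 + x‖ = 1 := norm_eq_one_of_norm_sub_one_lt (by simpa using hx1)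
  have hxx : ‖x‖ * ‖x‖ < ‖x‖ := by nlinarith
  rcases h2x.eq_or_lt with h2e | h2l
  -- Here $2/x$ is a unit. Its residue is an odd integer, hence $-1$, so $2+x$ vanishes modulo $x^2$
  -- and $(1+x)^2\equiv 1$ modulo $x^3$. Only $1$ and $1+x$ occur modulo $x^3$, and $1+x^2$ is
  -- missed.
  · have hres : ‖(2 : K) + x‖ ≤ ‖x‖ * ‖x‖ := by
      refine h.norm_le_mul ?_
      obtain ⟨j, hj⟩ := h.exists_natCast (y := 2 / x) (by rw [norm_div, h2e, div_self hx0.ne'])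
      have hodd : ¬ 2 ∣ j := by
        intro hd
        have := norm_natCast_le_of_dvd (K := K) hd
        have h3 : ‖(2 : K) / x‖ ≤ ‖x‖ := by
          have e : (2 : K) / x = (2 / x - j) + j := by ring
          rw [e]
          exact norm_add_le_of_le hj (this.trans (by simpa using h2x))
        rw [norm_div, h2e, div_self hx0.ne'] at h3
        linarith
      have h3 : ‖(2 : K) / x + 1‖ ≤ ‖x‖ := by
        have e : (2 : K) / x + 1 = (2 / x - j) + ((j + 1 : ℕ) : K) := by push_cast; ring
        rw [e]
        refine norm_add_le_of_le hj ((norm_natCast_le_of_dvd (p := 2) (by omega)).trans ?_)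
        simpa using h2x
      have e : (2 : K) + x = (2 / x + 1) * x := by
        rw [add_mul, div_mul_cancel₀ _ h.ne_zero, one_mul]
      rw [e, norm_mul]
      exact (mul_le_mul_of_nonneg_right h3 hx0.le).trans_lt hxx
    have hsq : ‖(1 + x) ^ 2 - 1‖ ≤ ‖x‖ ^ 3 := by
      have e : (1 + x) ^ 2 - 1 = x * (2 + x) := by ring
      rw [e, norm_mul]
      calc ‖x‖ * ‖2 + x‖ ≤ ‖x‖ * (‖x‖ * ‖x‖) := by gcongr
        _ = ‖x‖ ^ 3 := by ring
    obtain ⟨j, hj⟩ := h.dense (x ^ 2) (by rw [norm_pow]; exact pow_lt_one₀ hx0.le hx1 two_ne_zero)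
      (‖x‖ ^ 3) (by positivity)
    have hev : ∀ i : ℕ, ‖(1 + x) ^ (2 * i) - 1‖ ≤ ‖x‖ ^ 3 := fun i => by
      rw [pow_mul]
      exact (norm_pow_sub_one_le (by rw [norm_pow, hl, one_pow]) i).trans hsq
    have h32 : ‖x‖ ^ 3 < ‖x‖ ^ 2 := pow_lt_pow_right_of_lt_one₀ hx0 hx1 (by norm_num)
    obtain ⟨i, rfl | rfl⟩ := Nat.even_or_odd' j
    · have e : x ^ 2 = ((1 + x) ^ (2 * i) - 1) - ((1 + x) ^ (2 * i) - (1 + x ^ 2)) := by ring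
      have : ‖x ^ 2‖ ≤ ‖x‖ ^ 3 := by
        rw [e]
        exact norm_sub_le_of_le (hev i) hj.le
      rw [norm_pow] at this
      linarith
    · have e : x = ((1 + x) ^ (2 * i + 1) - (1 + x ^ 2)) - (1 + x) * ((1 + x) ^ (2 * i) - 1)
          + x ^ 2 := by ring
      have : ‖x‖ ≤ ‖x‖ ^ 2 := by
        conv_lhs => rw [e]
        refine norm_add_le_of_le (norm_sub_le_of_le (hj.le.trans h32.le) ?_) (norm_pow _ _).le
        rw [norm_mul, hl, one_mul]
        exact (hev i).trans h32.le
      nlinarith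
  -- Now $|2|\le|x|^2$, so $(1+x)^4\equiv 1$ modulo $x^4$. The four remaining exponents are checked
  -- against the target $1+x^3$.
  · have h22 := h.norm_le_mul h2l
    have hsq : ‖(1 + x) ^ 2 - 1‖ ≤ ‖x‖ ^ 2 := by
      have e : (1 + x) ^ 2 - 1 = x * (2 + x) := by ring
      rw [e, norm_mul, pow_two]
      gcongr
      exact norm_add_le_of_le h2x le_rfl
    have h4 : ‖(1 + x) ^ 4 - 1‖ ≤ ‖x‖ ^ 4 := by
      have e : (1 + x) ^ 4 - 1 = ((1 + x) ^ 2 - 1) * (((1 + x) ^ 2 - 1) + 2) := by ring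
      rw [e, norm_mul]
      calc _ ≤ ‖x‖ ^ 2 * ‖x‖ ^ 2 := by
            gcongr
            exact norm_add_le_of_le hsq (h22.trans_eq (pow_two _).symm)
        _ = ‖x‖ ^ 4 := by ring
    obtain ⟨j, hj⟩ := h.dense (x ^ 3)
      (by rw [norm_pow]; exact pow_lt_one₀ hx0.le hx1 three_ne_zero) (‖x‖ ^ 4) (by positivity)
    have h43 : ‖x‖ ^ 4 < ‖x‖ ^ 3 := pow_lt_pow_right_of_lt_one₀ hx0 hx1 (by norm_num)
    have h32 : ‖x‖ ^ 3 < ‖x‖ ^ 2 := pow_lt_pow_right_of_lt_one₀ hx0 hx1 (by norm_num)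
    have h21 : ‖x‖ ^ 2 < ‖x‖ := by rwa [pow_two]
    have hr : ‖(1 + x) ^ (j % 4) - (1 + x ^ 3)‖ ≤ ‖x‖ ^ 4 := by
      have e : (1 + x) ^ (j % 4) - (1 + x ^ 3) = ((1 + x) ^ j - (1 + x ^ 3))
          - (1 + x) ^ (j % 4) * (((1 + x) ^ 4) ^ (j / 4) - 1) := by
        have : (1 + x) ^ j = (1 + x) ^ (j % 4) * ((1 + x) ^ 4) ^ (j / 4) := by
          rw [← pow_mul, ← pow_add, Nat.mod_add_div]
        rw [this]; ring
      rw [e]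
      refine norm_sub_le_of_le hj.le ?_
      rw [norm_mul, norm_pow, hl, one_pow, one_mul]
      exact (norm_pow_sub_one_le (by rw [norm_pow, hl, one_pow]) _).trans h4
    have hx3 : ‖x ^ 3‖ = ‖x‖ ^ 3 := norm_pow _ _
    have hlt : j % 4 < 4 := Nat.mod_lt _ (by norm_num)
    generalize j % 4 = r at hr hlt
    interval_cases r
    · have e : (1 + x) ^ 0 - (1 + x ^ 3) = -x ^ 3 := by ring
      rw [e, norm_neg, hx3] at hr
      linarith
    · have e : x = ((1 + x) ^ 1 - (1 + x ^ 3)) + x ^ 3 := by ring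
      have : ‖x‖ ≤ ‖x‖ ^ 3 := by
        conv_lhs => rw [e]
        exact norm_add_le_of_le (hr.trans h43.le) hx3.le
      linarith
    · have e : x ^ 2 = ((1 + x) ^ 2 - (1 + x ^ 3)) + x ^ 3 - 2 * x := by ring
      have : ‖x ^ 2‖ ≤ ‖x‖ ^ 3 := by
        rw [e]
        refine norm_sub_le_of_le (norm_add_le_of_le (hr.trans h43.le) hx3.le) ?_
        rw [norm_mul]
        calc _ ≤ ‖x‖ * ‖x‖ * ‖x‖ := by gcongr
          _ = ‖x‖ ^ 3 := by ring
      rw [norm_pow] at this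
      linarith
    · have e : x = ((1 + x) ^ 3 - (1 + x ^ 3)) + x ^ 3 - (1 + x) * ((1 + x) ^ 2 - 1) := by ring
      have : ‖x‖ ≤ ‖x‖ ^ 2 := by
        conv_lhs => rw [e]
        refine norm_sub_le_of_le (norm_add_le_of_le (by linarith) (by linarith)) ?_
        rw [norm_mul, hl, one_mul]
        exact hsq
      linarith

end IsPrincipalGenerator

/-- If the powers of a unit are dense in the unit sphere, then the residue field is a prime field
of odd characteristic `p`, and `p` is a uniformizer. -/
theorem HasDensePowers.exists_prime (h : HasDensePowers lam) (hlam : ‖lam‖ = 1) :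
    ∃ p : ℕ, p.Prime ∧ p ≠ 2 ∧ (p : K) ≠ 0 ∧ ‖(p : K)‖ < 1 ∧
      ∀ y : K, ‖y‖ ≤ 1 → ∃ n : ℕ, ‖y - n‖ ≤ ‖(p : K)‖ := by
  obtain ⟨l, hl, hd⟩ := h.exists_principal_generator hlam
  have hg : IsPrincipalGenerator (l - 1) := by
    have hd' : ∀ y : K, ‖y‖ < 1 → ∀ ε > 0, ∃ n : ℕ, ‖(1 + (l - 1)) ^ n - (1 + y)‖ < ε :=
      fun y hy ε hε => by
        rw [add_sub_cancel]
        exact hd (1 + y) (by simpa using hy) ε hε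
    refine ⟨fun h0 => ?_, hl, hd'⟩
    obtain ⟨y, hy0, hy1⟩ := NormedField.exists_norm_lt_one K
    obtain ⟨n, hn⟩ := hd' y hy1 ‖y‖ hy0
    rw [h0] at hn
    simp at hn
  obtain ⟨p, hp, hpn⟩ := hg.exists_prime
  have hp2 : p ≠ 2 := by
    rintro rfl
    have := hg.one_le_norm_two
    push_cast at hpn
    linarith
  have he := hg.norm_prime_of_ne_two hp hp2 hpn
  refine ⟨p, hp, hp2, ?_, hpn, fun y hy => ?_⟩
  · rw [← norm_pos_iff, he]
    exact norm_pos_iff.2 hg.ne_zero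
  · rw [he]
    exact hg.exists_natCast hy

end DensePowers

/-- The natural numbers are dense in the unit ball. -/
theorem exists_natCast_norm_sub_le {K : Type*} [NormedField K] {p : ℕ} (hp0 : (p : K) ≠ 0)
    (hn : ∀ y : K, ‖y‖ ≤ 1 → ∃ n : ℕ, ‖y - n‖ ≤ ‖(p : K)‖) {y : K} (hy : ‖y‖ ≤ 1) (N : ℕ) :
    ∃ n : ℕ, ‖y - n‖ ≤ ‖(p : K)‖ ^ N := by
  induction N with
  | zero => exact ⟨0, by simpa using hy⟩
  | succ N ih =>
    obtain ⟨n, hn'⟩ := ih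
    have hpp : 0 < ‖(p : K)‖ := norm_pos_iff.2 hp0
    obtain ⟨k, hk⟩ := hn ((y - n) / p ^ N)
      (by rw [norm_div, norm_pow]; exact div_le_one_of_le₀ hn' (by positivity))
    refine ⟨n + p ^ N * k, ?_⟩
    have e : y - ((n + p ^ N * k : ℕ) : K) = ((y - n) / p ^ N - k) * p ^ N := by
      push_cast
      field_simp
      ring
    rw [e, norm_mul, norm_pow, pow_succ, mul_comm]
    gcongr

/-! ### Recognizing the field of `p`-adic numbers -/

section Recognition

variable {K : Type*} [NontriviallyNormedField K] {p : ℕ}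

variable (K) in
/-- The embedding of `ℚ` with the `p`-adic topology into `K`. -/
def padicRatHom (p : ℕ) [Fact p.Prime] [CharZero K] :
    (Rat.castHom ℚ_[p]).fieldRange →+* K :=
  (Rat.castHom K).comp
    (RingEquiv.ofBijective (Rat.castHom ℚ_[p]).rangeRestrictField
      ⟨RingHom.injective _, RingHom.rangeRestrictField_bijective _ |>.2⟩).symm.toRingHom

theorem padicRatHom_apply [Fact p.Prime] [CharZero K] (q : ℚ)
    (h : (q : ℚ_[p]) ∈ (Rat.castHom ℚ_[p]).fieldRange) :
    padicRatHom K p ⟨q, h⟩ = q := by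
  have : (⟨q, h⟩ : (Rat.castHom ℚ_[p]).fieldRange) =
    (RingEquiv.ofBijective (Rat.castHom ℚ_[p]).rangeRestrictField
      ⟨RingHom.injective _, RingHom.rangeRestrictField_bijective _ |>.2⟩) q := rfl
  rw [this]
  simp [padicRatHom]

variable [IsUltrametricDist K]

theorem charZero_of_norm_prime_lt_one (hp : p.Prime) (hp0 : (p : K) ≠ 0) (hp1 : ‖(p : K)‖ < 1) :
    CharZero K := by
  refine charZero_of_inj_zero fun n hn => ?_
  by_contra h0
  obtain ⟨a, m, hm, rfl⟩ := Nat.exists_eq_pow_mul_and_not_dvd h0 p hp.ne_one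
  push_cast at hn
  have hm0 : (m : K) = 0 := (mul_eq_zero.1 hn).resolve_left (pow_ne_zero _ hp0)
  exact hm (dvd_of_norm_natCast_lt_one hp hp1 (by rw [hm0, norm_zero]; exact one_pos))

/-- A rational that is $p$-integral has a denominator prime to $p$, and such an integer is a unit in
$K$. This comparison makes the map from $\mathbb{Q}$ with the $p$-adic topology into $K$ continuous.
-/
theorem norm_ratCast_le_one [Fact p.Prime] [CharZero K] (hp1 : ‖(p : K)‖ < 1) {q : ℚ}
    (hq : ‖(q : ℚ_[p])‖ ≤ 1) : ‖(q : K)‖ ≤ 1 := by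
  have hd : ¬ p ∣ q.den := by
    intro hd
    have hn : ¬ p ∣ q.num.natAbs := fun hn =>
      (Fact.out : p.Prime).one_lt.ne' (Nat.dvd_one.1 (q.reduced ▸ Nat.dvd_gcd hn hd))
    have h1 : ‖(q.num : ℚ_[p])‖ = 1 := by
      refine le_antisymm (Padic.norm_int_le_one _) (not_lt.1 fun hlt => hn ?_)
      rw [Padic.norm_intCast_lt_one_iff] at hlt
      exact Int.natCast_dvd.1 hlt
    have h2 : ‖(q.den : ℚ_[p])‖ < 1 := by
      rw [Padic.norm_natCast_lt_one_iff]; exact hd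
    have hd0 : 0 < ‖(q.den : ℚ_[p])‖ := norm_pos_iff.2 (by exact_mod_cast q.den_nz)
    rw [Rat.cast_def, norm_div, h1, div_le_one hd0] at hq
    linarith
  have h1 : ‖(q.den : K)‖ = 1 :=
    le_antisymm (norm_natCast_le_one' _)
      (not_lt.1 fun h => hd (dvd_of_norm_natCast_lt_one Fact.out hp1 h))
  rw [Rat.cast_def, norm_div, h1, div_one]
  exact norm_intCast_le_one' _

theorem norm_ratCast_le_pow [Fact p.Prime] [CharZero K] (hp1 : ‖(p : K)‖ < 1) {q : ℚ} {N : ℕ}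
    (hq : ‖(q : ℚ_[p])‖ ≤ ‖(p : ℚ_[p])‖ ^ N) : ‖(q : K)‖ ≤ ‖(p : K)‖ ^ N := by
  have hp0 : (p : ℚ) ≠ 0 := by exact_mod_cast (Fact.out : p.Prime).ne_zero
  have hpp : 0 < ‖(p : ℚ_[p])‖ := norm_pos_iff.2 (by exact_mod_cast (Fact.out : p.Prime).ne_zero)
  have hpK : 0 < ‖(p : K)‖ := norm_pos_iff.2 (by exact_mod_cast (Fact.out : p.Prime).ne_zero)
  have := norm_ratCast_le_one (K := K) hp1 (q := q / p ^ N) (by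
    push_cast
    rw [norm_div, norm_pow]
    exact div_le_one_of_le₀ hq (by positivity))
  push_cast at this
  rwa [norm_div, norm_pow, div_le_one (by positivity)] at this

theorem uniformContinuous_padicRatHom [Fact p.Prime] [CharZero K] (hp1 : ‖(p : K)‖ < 1) :
    UniformContinuous (padicRatHom K p) := by
  refine uniformContinuous_of_continuousAt_zero _ ?_
  rw [Metric.continuousAt_iff]
  intro ε hε
  obtain ⟨N, hN⟩ := exists_pow_lt_of_lt_one hε hp1
  have hpp : 0 < ‖(p : ℚ_[p])‖ := norm_pos_iff.2 (by exact_mod_cast (Fact.out : p.Prime).ne_zero)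
  refine ⟨‖(p : ℚ_[p])‖ ^ N, by positivity, ?_⟩
  rintro ⟨x, q, rfl⟩ hx
  rw [map_zero, dist_zero_right]
  have e : padicRatHom K p ⟨Rat.castHom ℚ_[p] q, q, rfl⟩ = q := padicRatHom_apply q ⟨q, rfl⟩
  rw [e]
  refine (norm_ratCast_le_pow hp1 ?_).trans_lt hN
  rw [Subtype.dist_eq] at hx
  simpa using hx.le

variable [CompleteSpace K]

/-- A field in which `p` is a uniformizer with residue field `ℤ/pℤ` is the field of `p`-adic
numbers, as a topological field. -/
theorem exists_padic_ringEquiv [Fact p.Prime] (hp0 : (p : K) ≠ 0) (hp1 : ‖(p : K)‖ < 1)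
    (hn : ∀ y : K, ‖y‖ ≤ 1 → ∃ n : ℕ, ‖y - n‖ ≤ ‖(p : K)‖) :
    ∃ e : K ≃+* ℚ_[p], Continuous e ∧ Continuous e.symm ∧ ∀ y : K, ‖y‖ ≤ 1 → ‖e y‖ ≤ 1 := by
  have hc : CharZero K := charZero_of_norm_prime_lt_one Fact.out hp0 hp1
  have hpK : 0 < ‖(p : K)‖ := norm_pos_iff.2 hp0
  have hpP : 0 < ‖(p : ℚ_[p])‖ := norm_pos_iff.2 (by exact_mod_cast (Fact.out : p.Prime).ne_zero)
  have hpP1 : ‖(p : ℚ_[p])‖ < 1 := Padic.norm_p_lt_one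
  have hu : IsUniformInducing (Rat.castHom ℚ_[p]).fieldRange.subtype :=
    isUniformEmbedding_subtype_val.isUniformInducing
  have hd : DenseRange (Rat.castHom ℚ_[p]).fieldRange.subtype := by
    refine (Padic.denseRange_ratCast p).mono ?_
    rintro _ ⟨q, rfl⟩
    exact ⟨⟨q, q, rfl⟩, rfl⟩
  have huc := uniformContinuous_padicRatHom (K := K) hp1
  set φ : ℚ_[p] →+* K := IsDenseInducing.extendRingHom hu hd huc with hφ
  have hφc : Continuous φ := (uniformContinuous_uniformly_extend hu hd huc).continuous
  -- The image of $\mathbb{Z}_p$ is compact, hence closed, and it contains the natural numbers,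
  -- which are dense in the unit ball of $K$.
  have hball : ∀ y : K, ‖y‖ ≤ 1 → ∃ x : ℚ_[p], ‖x‖ ≤ 1 ∧ φ x = y := by
    intro y hy
    have hcl : IsClosed (φ '' Metric.closedBall 0 1) :=
      ((isCompact_closedBall _ _).image hφc).isClosed
    suffices y ∈ closure (φ '' Metric.closedBall 0 1) by
      rw [hcl.closure_eq] at this
      obtain ⟨x, hx, rfl⟩ := this
      exact ⟨x, by simpa using hx, rfl⟩
    rw [Metric.mem_closure_iff]
    intro ε hε
    obtain ⟨N, hN⟩ := exists_pow_lt_of_lt_one hε hp1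
    obtain ⟨n, hn'⟩ := exists_natCast_norm_sub_le hp0 hn hy N
    refine ⟨n, ⟨n, ?_, map_natCast φ n⟩, ?_⟩
    · simpa using norm_natCast_le_one' (K := ℚ_[p]) n
    · rw [dist_eq_norm]
      exact hn'.trans_lt hN
  have hsurj : Function.Surjective φ := by
    intro y
    obtain ⟨N, hN⟩ := exists_pow_lt_of_lt_one (x := (‖y‖ + 1)⁻¹) (by positivity) hp1
    obtain ⟨x, -, hx⟩ := hball (p ^ N * y) (by
      rw [norm_mul, norm_pow]
      calc _ ≤ (‖y‖ + 1)⁻¹ * (‖y‖ + 1) := by gcongr; linarith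
        _ = 1 := inv_mul_cancel₀ (by positivity))
    refine ⟨x / p ^ N, ?_⟩
    rw [map_div₀, hx, map_pow, map_natCast]
    field_simp
  let e : ℚ_[p] ≃+* K := RingEquiv.ofBijective φ ⟨φ.injective, hsurj⟩
  have he : ∀ y : K, ‖y‖ ≤ 1 → ‖e.symm y‖ ≤ 1 := by
    intro y hy
    obtain ⟨x, hx, rfl⟩ := hball y hy
    have : e.symm (φ x) = x := e.symm_apply_apply x
    rwa [this]
  refine ⟨e.symm, ?_, hφc, he⟩
  refine continuous_of_continuousAt_zero e.symm ?_
  rw [Metric.continuousAt_iff]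
  intro ε hε
  obtain ⟨N, hN⟩ := exists_pow_lt_of_lt_one hε hpP1
  refine ⟨‖(p : K)‖ ^ N, by positivity, fun {y} hy => ?_⟩
  rw [map_zero, dist_zero_right]
  rw [dist_zero_right] at hy
  have h1 := he (y / p ^ N) (by
    rw [norm_div, norm_pow]
    exact div_le_one_of_le₀ hy.le (by positivity))
  rw [map_div₀, map_pow, map_natCast, norm_div, norm_pow, div_le_one (by positivity)] at h1
  exact h1.trans_lt hN

/-- A complete field in which the powers of a unit are dense in the unit sphere is a field of
`p`-adic numbers with `p` odd, and the unit generates `(ℤ/p²ℤ)ˣ`. -/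
theorem HasDensePowers.isPadicWithGenerator {lam : K} (h : HasDensePowers lam) (hlam : ‖lam‖ = 1) :
    IsPadicWithGenerator lam := by
  obtain ⟨p, hp, hp2, hp0, hp1, hn⟩ := h.exists_prime hlam
  have hF : Fact p.Prime := ⟨hp⟩
  obtain ⟨e, he, he', hb⟩ := exists_padic_ringEquiv hp0 hp1 hn
  refine ⟨p, hF, hp2, e, he, he', ?_⟩
  have hlam0 : lam ≠ 0 := by rintro rfl; simp at hlam
  let z : ℤ_[p] := ⟨e lam, hb lam hlam.le⟩
  let w : ℤ_[p] := ⟨e lam⁻¹, hb lam⁻¹ (by simp [hlam])⟩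
  have hzw : z * w = 1 := by
    apply Subtype.ext
    change e lam * e lam⁻¹ = 1
    rw [← map_mul, mul_inv_cancel₀ hlam0, map_one]
  let v : ℤ_[p]ˣ := ⟨z, w, hzw, by rw [mul_comm, hzw]⟩
  refine ⟨z, Units.map (PadicInt.toZModPow 2 : ℤ_[p] →+* ZMod (p ^ 2)).toMonoidHom v, rfl, rfl, ?_⟩
  rw [Subgroup.eq_top_iff']
  intro u
  have hcop : Nat.Coprime (u : ZMod (p ^ 2)).val p :=
    (Nat.coprime_pow_right_iff two_pos _ _).1 (ZMod.val_coe_unit_coprime u)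
  have hm1 : ‖((u : ZMod (p ^ 2)).val : K)‖ = 1 := by
    refine le_antisymm (norm_natCast_le_one' _) (not_lt.1 fun hlt => ?_)
    have := dvd_of_norm_natCast_lt_one hp hp1 hlt
    exact hp.one_lt.ne' (Nat.dvd_one.1 (hcop ▸ Nat.dvd_gcd this dvd_rfl))
  obtain ⟨n, hn'⟩ := h _ hm1 (‖(p : K)‖ ^ 2) (by have := norm_pos_iff.2 hp0; positivity)
  refine ⟨n, ?_⟩
  -- The approximation is divisible by $p^2$ inside $K$. Since `e` maps integral elements to
  -- integral ones, the congruence modulo $p^2$ carries over to $\mathbb{Z}_p$.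
  let t : ℤ_[p] := ⟨e ((lam ^ n - (u : ZMod (p ^ 2)).val) / p ^ 2), hb _ (by
    rw [norm_div, norm_pow]
    exact div_le_one_of_le₀ hn'.le (by positivity))⟩
  have ht : z ^ n = ((u : ZMod (p ^ 2)).val : ℤ_[p]) + p ^ 2 * t := by
    apply Subtype.ext
    push_cast
    change (e lam) ^ n = _ + _ * e _
    rw [map_div₀, map_sub, map_pow, map_natCast, map_pow, map_natCast]
    have : (p : ℚ_[p]) ≠ 0 := by exact_mod_cast hp.ne_zero
    field_simp
    ring
  apply Units.ext
  simp only [zpow_natCast, Units.val_pow_eq_pow_val]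
  change (PadicInt.toZModPow 2 z) ^ n = _
  rw [← map_pow, ht, map_add, map_mul, map_pow, map_natCast, map_natCast]
  have : ((p : ZMod (p ^ 2)) ^ 2) = 0 := by exact_mod_cast ZMod.natCast_self (p ^ 2)
  have hne : NeZero (p ^ 2) := ⟨pow_ne_zero 2 hp.ne_zero⟩
  rw [this, zero_mul, add_zero, ZMod.natCast_zmod_val]

end Recognition

/-! ### Transitivity of multiplier maps -/

section Transitive

variable {K : Type*} [NontriviallyNormedField K] {lam : K}

theorem hasDensePowers_of_isTransitiveOn {r : ℝ} (hr : 0 < r)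
    (h : IsTransitiveOn (fun x : K => lam * x) (Metric.sphere 0 r)) : HasDensePowers lam := by
  obtain ⟨-, x, hx, hd⟩ := h
  have hxr : ‖x‖ = r := by simpa using hx
  have hx0 : x ≠ 0 := norm_pos_iff.1 (hxr ▸ hr)
  intro u hu ε hε
  have hux : u * x ∈ Metric.sphere (0 : K) r := by simp [hu, hxr]
  obtain ⟨_, ⟨n, rfl⟩, hn⟩ := Metric.mem_closure_iff.1 (hd hux) (ε * r) (by positivity)
  refine ⟨n, ?_⟩
  have e : (fun x : K => lam * x)^[n] x = lam ^ n * x := by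
    rw [mul_left_iterate]
  simp only [e] at hn
  rw [dist_comm, dist_eq_norm, ← sub_mul, norm_mul, hxr] at hn
  exact lt_of_mul_lt_mul_right hn hr.le

/-- The line $\mathbb{Q}_p\cdot 1$ is closed and contains the natural numbers, which density of
powers makes dense in the unit ball. So the line contains the ball and, by scaling, all of $K$. -/
theorem not_isTransitiveOn_of_finiteDimensional (p : ℕ) [Fact p.Prime] [IsUltrametricDist K]
    [NormedAlgebra ℚ_[p] K] [FiniteDimensional ℚ_[p] K] (hrank : 1 < Module.finrank ℚ_[p] K)
    (hlam : ‖lam‖ = 1) {r : ℝ} (hr : 0 < r) :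
    ¬ IsTransitiveOn (fun x : K => lam * x) (Metric.sphere 0 r) := by
  intro h
  obtain ⟨q, hq, -, hq0, hq1, hn⟩ := (hasDensePowers_of_isTransitiveOn hr h).exists_prime hlam
  have hcl : IsClosed ((1 : Submodule ℚ_[p] K) : Set K) := Submodule.closed_of_finiteDimensional _
  have hball : ∀ y : K, ‖y‖ ≤ 1 → y ∈ (1 : Submodule ℚ_[p] K) := by
    intro y hy
    have : y ∈ closure ((1 : Submodule ℚ_[p] K) : Set K) := by
      rw [Metric.mem_closure_iff]
      intro ε hε
      obtain ⟨N, hN⟩ := exists_pow_lt_of_lt_one hε hq1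
      obtain ⟨n, hn'⟩ := exists_natCast_norm_sub_le hq0 hn hy N
      exact ⟨n, Submodule.mem_one.2 ⟨n, map_natCast _ n⟩, by rw [dist_eq_norm]; exact hn'.trans_lt hN⟩
    rwa [hcl.closure_eq] at this
  have htop : (1 : Submodule ℚ_[p] K) = ⊤ := by
    rw [Submodule.eq_top_iff']
    intro y
    obtain ⟨c, hc⟩ := NormedField.exists_lt_norm ℚ_[p] ‖y‖
    have hc0 : c ≠ 0 := norm_pos_iff.1 ((norm_nonneg _).trans_lt hc)
    have : c⁻¹ • y ∈ (1 : Submodule ℚ_[p] K) := by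
      apply hball
      rw [norm_smul, norm_inv, inv_mul_le_one₀ (norm_pos_iff.2 hc0)]
      exact hc.le
    simpa [smul_smul, hc0] using Submodule.smul_mem _ c this
  have : Module.finrank ℚ_[p] K ≤ 1 := by
    rw [← finrank_top, ← htop, Submodule.one_eq_span]
    exact (finrank_span_le_card _).trans (by simp)
  omega

/-- Density of powers yields a prime that is nonzero in $K$ and of norm less than 1. It divides $p$,
which has norm 0, so it equals $p$ and is zero after all. -/
theorem not_isTransitiveOn_of_charP (p : ℕ) [Fact p.Prime] [IsUltrametricDist K] [CharP K p]
    (hlam : ‖lam‖ = 1) {r : ℝ} (hr : 0 < r) :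
    ¬ IsTransitiveOn (fun x : K => lam * x) (Metric.sphere 0 r) := by
  intro h
  obtain ⟨q, hq, -, hq0, hq1, -⟩ := (hasDensePowers_of_isTransitiveOn hr h).exists_prime hlam
  have hd : q ∣ p := dvd_of_norm_natCast_lt_one (K := K) hq hq1 (by simp)
  rw [(Nat.prime_dvd_prime_iff_eq hq Fact.out).1 hd] at hq0
  simp at hq0

end Transitive

/-! ### Transport of ergodicity along a topological conjugacy -/

section Conjugacy

variable {X Y : Type*} [TopologicalSpace X] [MeasurableSpace X] [BorelSpace X]
  [TopologicalSpace Y] [MeasurableSpace Y] [BorelSpace Y] {T : X → X} {T' : Y → Y}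

theorem measurePreserving_homeomorph (Φ : X ≃ₜ Y) (μ : Measure X) :
    MeasurePreserving Φ.toMeasurableEquiv μ (μ.map Φ) :=
  ⟨Φ.toMeasurableEquiv.measurable, rfl⟩

theorem conj_eq (Φ : X ≃ₜ Y) (h : ∀ x, Φ (T x) = T' (Φ x)) :
    Φ.toMeasurableEquiv ∘ T ∘ Φ.toMeasurableEquiv.symm = T' := by
  funext y
  change Φ (T (Φ.symm y)) = T' y
  rw [h, Φ.apply_symm_apply]

theorem IsInvariantFullMeasure.map {μ : Measure X} (hμ : IsInvariantFullMeasure T μ) (Φ : X ≃ₜ Y)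
    (h : ∀ x, Φ (T x) = T' (Φ x)) : IsInvariantFullMeasure T' (μ.map Φ) := by
  have hp := hμ.prob
  have ho := hμ.pos
  have hm := measurePreserving_homeomorph Φ μ
  refine ⟨Measure.isProbabilityMeasure_map Φ.continuous.measurable.aemeasurable, ?_,
    Φ.continuous.isOpenPosMeasure_map Φ.surjective⟩
  rw [← conj_eq Φ h]
  exact (hm.comp hμ.invariant).comp (hm.symm _)

theorem ergodic_map_iff {μ : Measure X} (Φ : X ≃ₜ Y) (h : ∀ x, Φ (T x) = T' (Φ x)) :
    Ergodic T' (μ.map Φ) ↔ Ergodic T μ := by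
  rw [← conj_eq Φ h]
  exact (measurePreserving_homeomorph Φ μ).ergodic_conjugate_iff

theorem IsErgodicForSome.conj (hT : IsErgodicForSome T) (Φ : X ≃ₜ Y)
    (h : ∀ x, Φ (T x) = T' (Φ x)) : IsErgodicForSome T' := by
  obtain ⟨μ, hμ, he⟩ := hT
  exact ⟨μ.map Φ, hμ.map Φ h, (ergodic_map_iff Φ h).2 he⟩

theorem IsErgodicForAll.conj (hT : IsErgodicForAll T) (Φ : X ≃ₜ Y)
    (h : ∀ x, Φ (T x) = T' (Φ x)) : IsErgodicForAll T' := by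
  have h' : ∀ y, Φ.symm (T' y) = T (Φ.symm y) := fun y => by
    rw [Φ.symm_apply_eq, h, Φ.apply_symm_apply]
  obtain ⟨⟨μ, hμ⟩, hall⟩ := hT
  exact ⟨⟨μ.map Φ, hμ.map Φ h⟩, fun ν hν =>
    (ergodic_map_iff Φ.symm h').1 (hall _ (hν.map Φ.symm h'))⟩

end Conjugacy

/-! ### Rotations of the unit sphere -/

section UnitSphere

variable {K : Type*} [NontriviallyNormedField K]

theorem dist_mul_left_unitSphere (a x y : Metric.sphere (0 : K) 1) :
    dist (a * x) (a * y) = dist x y := by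
  have ha : ‖(a : K)‖ = 1 := by simp
  rw [Subtype.dist_eq, Subtype.dist_eq, dist_eq_norm, dist_eq_norm, Metric.unitSphere.coe_mul,
    Metric.unitSphere.coe_mul, ← mul_sub, norm_mul, ha, one_mul]

theorem dist_mul_right_unitSphere (a x y : Metric.sphere (0 : K) 1) :
    dist (x * a) (y * a) = dist x y := by
  rw [mul_comm x, mul_comm y, dist_mul_left_unitSphere]

theorem HasDensePowers.denseRange_pow {lam : Metric.sphere (0 : K) 1}
    (h : HasDensePowers (lam : K)) : DenseRange (lam ^ · : ℕ → Metric.sphere (0 : K) 1) := by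
  intro u
  rw [Metric.mem_closure_iff]
  intro ε hε
  obtain ⟨n, hn⟩ := h u (by simp) ε hε
  refine ⟨lam ^ n, ⟨n, rfl⟩, ?_⟩
  rwa [dist_comm, Subtype.dist_eq, dist_eq_norm, Metric.unitSphere.coe_pow]

variable [IsUltrametricDist K]

/-- In an ultrametric space two rotations closer than $r$ cannot be told apart by balls of radius
$r$. This is how invariance under the powers of $\lambda$ spreads to all rotations. -/
theorem preimage_mul_ball_eq {a b x : Metric.sphere (0 : K) 1} {r : ℝ} (h : dist a b < r) :
    (a * ·) ⁻¹' Metric.ball x r = (b * ·) ⁻¹' Metric.ball x r := by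
  ext y
  rw [← dist_mul_right_unitSphere y] at h
  simp only [Set.mem_preimage, Metric.mem_ball]
  constructor <;> intro h'
  · exact (IsUltrametricDist.dist_triangle_max _ (a * y) _).trans_lt
      (max_lt (by rwa [dist_comm]) h')
  · exact (IsUltrametricDist.dist_triangle_max _ (b * y) _).trans_lt (max_lt h h')

variable [MeasurableSpace K] [BorelSpace K] {lam : Metric.sphere (0 : K) 1}

theorem hasDensePowers_of_ergodic {μ : Measure (Metric.sphere (0 : K) 1)}
    (hμ : IsInvariantFullMeasure (lam * ·) μ) (he : Ergodic (lam * ·) μ) :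
    HasDensePowers (lam : K) := by
  have hp := hμ.prob
  have ho := hμ.pos
  intro u hu ε hε
  let u' : Metric.sphere (0 : K) 1 := ⟨u, by simpa using hu⟩
  have hd : DenseRange (lam ^ · : ℤ → Metric.sphere (0 : K) 1) := .zpow_of_ergodic_mul_left he
  obtain ⟨m, hm⟩ := hd.exists_dist_lt u' hε
  -- Poincaré recurrence for a ball about 1 gives $k>0$ with $\lambda^k$ near 1. Multiplying
  -- $\lambda^m$ by a power of $\lambda^k$ then makes a negative exponent nonnegative without
  -- leaving the target ball.
  obtain ⟨y, hy, k, hk, hyk⟩ := hμ.invariant.conservative.exists_mem_iterate_mem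
    (s := Metric.ball (1 : Metric.sphere (0 : K) 1) ε)
    Metric.isOpen_ball.measurableSet.nullMeasurableSet
    (Metric.isOpen_ball.measure_ne_zero μ ⟨1, Metric.mem_ball_self hε⟩)
  have hret : dist (lam ^ k) 1 < ε := by
    rw [mul_left_iterate] at hyk
    rw [← dist_mul_right_unitSphere y, one_mul]
    exact (IsUltrametricDist.dist_triangle_max _ 1 _).trans_lt
      (max_lt hyk (by rw [dist_comm]; exact hy))
  obtain ⟨n, hn⟩ : ∃ n : ℕ, (n : ℤ) = m + k * m.natAbs := by
    refine ⟨(m + k * m.natAbs).toNat, Int.toNat_of_nonneg ?_⟩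
    have h1 : (1 : ℤ) ≤ k := by exact_mod_cast Nat.one_le_iff_ne_zero.2 hk
    have h2 : -(m.natAbs : ℤ) ≤ m := by omega
    nlinarith [Int.natCast_nonneg m.natAbs]
  refine ⟨n, ?_⟩
  have e : lam ^ n = lam ^ m * (lam ^ k) ^ m.natAbs := by
    rw [← zpow_natCast lam n, hn, zpow_add, zpow_mul, zpow_natCast, zpow_natCast]
  have hlt : dist (lam ^ n) u' < ε := by
    refine (IsUltrametricDist.dist_triangle_max _ (lam ^ m) _).trans_lt
      (max_lt ?_ (by rw [dist_comm]; exact hm))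
    rw [e]
    conv_lhs => rw [← mul_one (lam ^ m), mul_assoc, one_mul]
    rw [dist_mul_left_unitSphere]
    refine lt_of_le_of_lt ?_ hret
    rw [Subtype.dist_eq, Subtype.dist_eq, dist_eq_norm, dist_eq_norm, Metric.unitSphere.coe_pow,
      Metric.unitSphere.coe_one]
    exact norm_pow_sub_one_le (by simp) _
  rwa [Subtype.dist_eq, dist_eq_norm, Metric.unitSphere.coe_pow] at hlt

/-- Balls generate the Borel sets, and two intersecting balls meet in a ball, so they form a
π-system. On a ball, the rotation by $g$ acts like the rotation by a nearby power of $\lambda$. -/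
theorem isMulLeftInvariant_of_hasDensePowers [SecondCountableTopology (Metric.sphere (0 : K) 1)]
    (h : HasDensePowers (lam : K)) {μ : Measure (Metric.sphere (0 : K) 1)} [IsFiniteMeasure μ]
    (hμ : MeasurePreserving (lam * ·) μ μ) : μ.IsMulLeftInvariant := by
  refine ⟨fun g => ?_⟩
  let C : Set (Set (Metric.sphere (0 : K) 1)) := {s | ∃ x r, s = Metric.ball x r}
  have hC : borel (Metric.sphere (0 : K) 1) = MeasurableSpace.generateFrom C := by
    refine (TopologicalSpace.isTopologicalBasis_of_isOpen_of_nhds ?_ ?_).borel_eq_generateFrom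
    · rintro _ ⟨x, r, rfl⟩
      exact Metric.isOpen_ball
    · intro x u hx hu
      obtain ⟨r, hr, hru⟩ := Metric.isOpen_iff.1 hu x hx
      exact ⟨_, ⟨x, r, rfl⟩, Metric.mem_ball_self hr, hru⟩
  have hpi : IsPiSystem C := by
    rintro _ ⟨x, r, rfl⟩ _ ⟨y, s, rfl⟩ ⟨z, hz1, hz2⟩
    rw [IsUltrametricDist.ball_eq_of_mem hz1, IsUltrametricDist.ball_eq_of_mem hz2]
    refine ⟨z, min r s, ?_⟩
    ext w
    simp
  have hgm : Measurable (g * ·) := (continuous_const_mul g).measurable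
  have hfin : IsFiniteMeasure (μ.map (g * ·)) := Measure.isFiniteMeasure_map μ _
  refine ext_of_generate_finite C (BorelSpace.measurable_eq.trans hC) hpi ?_ ?_
  · rintro _ ⟨x, r, rfl⟩
    rw [Measure.map_apply hgm Metric.isOpen_ball.measurableSet]
    rcases le_or_gt r 0 with hr | hr
    · simp [Metric.ball_eq_empty.2 hr]
    · obtain ⟨n, hn⟩ := h.denseRange_pow.exists_dist_lt g hr
      rw [preimage_mul_ball_eq hn, ← mul_left_iterate]
      exact (hμ.iterate n).measure_preimage Metric.isOpen_ball.measurableSet.nullMeasurableSet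
  · rw [Measure.map_apply hgm .univ, Set.preimage_univ]

theorem isErgodicForAll_of_hasDensePowers [CompactSpace (Metric.sphere (0 : K) 1)]
    (h : HasDensePowers (lam : K)) :
    IsErgodicForAll (lam * · : Metric.sphere (0 : K) 1 → Metric.sphere (0 : K) 1) := by
  constructor
  · refine ⟨Measure.haarMeasure ⊤, ⟨⟨?_⟩, measurePreserving_mul_left _ _, inferInstance⟩⟩
    simpa using Measure.haarMeasure_self (K₀ := (⊤ : TopologicalSpace.PositiveCompacts
      (Metric.sphere (0 : K) 1)))
  · intro μ hμ
    have hp := hμ.prob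
    have hi := isMulLeftInvariant_of_hasDensePowers h hμ.invariant
    exact ergodic_mul_left_of_denseRange_pow h.denseRange_pow μ

end UnitSphere

/-! ### Zeros of power series on the closed unit ball -/

section PolynomialRoots

open Polynomial

variable {L : Type*} [NontriviallyNormedField L]

variable (L) in
/-- The norm of `L` as an absolute value. -/
def normAbs : AbsoluteValue L ℝ := IsAbsoluteValue.toAbsoluteValue (norm : L → ℝ)

theorem normAbs_apply (x : L) : normAbs L x = ‖x‖ := rfl

variable [IsUltrametricDist L]

theorem isNonarchimedean_normAbs : IsNonarchimedean (normAbs L) :=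
  IsUltrametricDist.isNonarchimedean_norm

theorem gaussNorm_X_sub_C {c : ℝ} (hc : 0 < c) (α : L) :
    (X - C α).gaussNorm (normAbs L) c = max c ‖α‖ := by
  apply le_antisymm
  · have h := isNonarchimedean_gaussNorm _ (isNonarchimedean_normAbs (L := L)) hc.le X (C (-α))
    have hX : (X : L[X]).gaussNorm (normAbs L) c = c := by
      rw [← monomial_one_one_eq_X, gaussNorm_monomial, normAbs_apply, norm_one, one_mul, pow_one]
    rwa [gaussNorm_C, hX, normAbs_apply, norm_neg, C_neg, ← sub_eq_add_neg] at h
  · apply max_le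
    · have h := le_gaussNorm (normAbs L) (X - C α) hc.le 1
      have h1 : (X - C α : L[X]).coeff 1 = 1 := by simp [coeff_X]
      rwa [h1, normAbs_apply, norm_one, one_mul, pow_one] at h
    · have h := le_gaussNorm (normAbs L) (X - C α) hc.le 0
      have h0 : (X - C α : L[X]).coeff 0 = -α := by simp
      rwa [h0, normAbs_apply, norm_neg, pow_zero, mul_one] at h

theorem gaussNorm_C_mul_prod {c : ℝ} (hc : 0 < c) (a : L) (s : Multiset L) :
    (C a * (s.map fun α => X - C α).prod).gaussNorm (normAbs L) c =
      ‖a‖ * (s.map fun α => max c ‖α‖).prod := by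
  rw [gaussNorm_mul isNonarchimedean_normAbs hc, gaussNorm_C, normAbs_apply]
  congr 1
  induction s using Multiset.induction_on with
  | empty => rw [Multiset.map_zero, Multiset.prod_zero, ← C_1, gaussNorm_C, normAbs_apply,
      norm_one, Multiset.map_zero, Multiset.prod_zero]
  | cons α s ih =>
    rw [Multiset.map_cons, Multiset.prod_cons, Multiset.map_cons, Multiset.prod_cons,
      gaussNorm_mul isNonarchimedean_normAbs hc, ih, gaussNorm_X_sub_C hc]

/-- The index $d$ of the last coefficient of maximal norm counts the roots in the closed unit ball.
After normalization the roots outside contribute a factor 1, so $|Q(z)|=\prod|z-\alpha|$ over the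
$d$ roots inside, and the root nearest to $z$ satisfies the estimate. -/
theorem exists_root_near [IsAlgClosed L] {Q : L[X]} {d : ℕ} (hd : d ≠ 0)
    (hle : ∀ i, ‖Q.coeff i‖ ≤ 1) (heq : ‖Q.coeff d‖ = 1) (hlt : ∀ i, d < i → ‖Q.coeff i‖ < 1)
    {z : L} (hz : ‖z‖ ≤ 1) :
    ∃ α : L, ‖α‖ ≤ 1 ∧ Q.eval α = 0 ∧ ‖z - α‖ ^ d ≤ ‖Q.eval z‖ := by
  classical
  have hQ0 : Q ≠ 0 := by rintro rfl; simp at heq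
  have hsp := IsAlgClosed.splits Q
  set S := Q.roots.filter fun α => ‖α‖ ≤ 1 with hS
  set B := Q.roots.filter fun α => ¬ ‖α‖ ≤ 1 with hB
  have hSB : S + B = Q.roots := Multiset.filter_add_not _ _
  have hBn : ∀ α ∈ B, 1 < ‖α‖ := fun α hα => not_le.1 (Multiset.mem_filter.1 hα).2
  have hSn : ∀ α ∈ S, ‖α‖ ≤ 1 := fun α hα => (Multiset.mem_filter.1 hα).2
  have hgauss : ∀ c : ℝ, 1 ≤ c → (∀ α ∈ B, c ≤ ‖α‖) → Q.gaussNorm (normAbs L) c =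
      ‖Q.leadingCoeff‖ * (B.map fun α => ‖α‖).prod * c ^ S.card := by
    intro c hc hcB
    conv_lhs => rw [hsp.eq_prod_roots]
    rw [gaussNorm_C_mul_prod (one_pos.trans_le hc), ← hSB, Multiset.map_add, Multiset.prod_add,
      Multiset.map_congr rfl (fun α hα => max_eq_left ((hSn α hα).trans hc)),
      Multiset.map_congr (s := B) rfl (fun α hα => max_eq_right (hcB α hα)),
      Multiset.map_const', Multiset.prod_replicate]
    ring
  have hg1 : Q.gaussNorm (normAbs L) 1 = 1 := by
    apply le_antisymm
    · obtain ⟨i, hi⟩ := Q.exists_eq_gaussNorm (normAbs L) 1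
      rw [hi, one_pow, mul_one]
      exact hle i
    · have := le_gaussNorm (normAbs L) Q zero_le_one d
      rwa [one_pow, mul_one, normAbs_apply, heq] at this
  have hlead : ‖Q.leadingCoeff‖ * (B.map fun α => ‖α‖).prod = 1 := by
    rw [hgauss 1 le_rfl fun α hα => (hBn α hα).le, one_pow, mul_one] at hg1
    exact hg1
  -- For $c$ slightly larger than 1 the Gauss norm of $Q$ is $c^d$ read off the coefficients and
  -- $c^{|S|}$ read off the roots.
  have hcard : S.card = d := by
    have h1 : ∀ᶠ c : ℝ in nhdsWithin 1 (Set.Ioi 1), ∀ α ∈ B.toFinset, c ≤ ‖α‖ := by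
      rw [Filter.eventually_all_finset]
      intro α hα
      exact nhdsWithin_le_nhds (eventually_le_nhds (hBn α (Multiset.mem_toFinset.1 hα)))
    have h2 : ∀ᶠ c : ℝ in nhdsWithin 1 (Set.Ioi 1), ∀ i ∈ Q.support,
        d < i → ‖Q.coeff i‖ * c ^ i ≤ 1 := by
      rw [Filter.eventually_all_finset]
      intro i _
      by_cases hi : d < i
      · have ht : Filter.Tendsto (fun c : ℝ => ‖Q.coeff i‖ * c ^ i) (nhds 1)
            (nhds (‖Q.coeff i‖ * 1 ^ i)) := by
          apply Continuous.tendsto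
          fun_prop
        rw [one_pow, mul_one] at ht
        filter_upwards [nhdsWithin_le_nhds (ht.eventually_le_const (hlt i hi))] with c hc _
        exact hc
      · exact Filter.Eventually.of_forall fun c h => absurd h hi
    obtain ⟨c, ⟨hc1, hc2⟩, hc⟩ := ((h1.and h2).and self_mem_nhdsWithin).exists
    have hc : 1 < c := hc
    have hg := hgauss c hc.le fun α hα => hc1 α (Multiset.mem_toFinset.2 hα)
    rw [hlead, one_mul] at hg
    have hgd : Q.gaussNorm (normAbs L) c = c ^ d := by
      apply le_antisymm
      · obtain ⟨i, hi⟩ := Q.exists_eq_gaussNorm (normAbs L) c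
        rw [hi, normAbs_apply]
        by_cases his : i ∈ Q.support
        · rcases lt_or_ge d i with hdi | hdi
          · exact (hc2 i his hdi).trans (one_le_pow₀ hc.le)
          · calc _ ≤ 1 * c ^ i := by gcongr; exact hle i
              _ ≤ c ^ d := by rw [one_mul]; exact pow_le_pow_right₀ hc.le hdi
        · rw [notMem_support_iff.1 his]
          simp only [norm_zero, zero_mul]
          positivity
      · have := le_gaussNorm (normAbs L) Q (zero_le_one.trans hc.le) d
        rwa [normAbs_apply, heq, one_mul] at this
    exact pow_right_injective₀ (one_pos.trans hc) hc.ne' (hg.symm.trans hgd)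
  have hprod : ‖Q.eval z‖ = (S.map fun α => ‖z - α‖).prod := by
    have hnorm : ∀ s : Multiset L, ‖(s.map fun α => z - α).prod‖ =
        (s.map fun α => ‖z - α‖).prod := fun s => by
      induction s using Multiset.induction_on with
      | empty => simp
      | cons a s ih => simp [ih]
    have hBz : ∀ α ∈ B, ‖z - α‖ = ‖α‖ := fun α hα => by
      rw [← norm_neg α]
      apply norm_eq_of_norm_sub_lt
      rw [sub_neg_eq_add, sub_add_cancel, norm_neg]
      exact hz.trans_lt (hBn α hα)
    rw [hsp.eval_eq_prod_roots, norm_mul, hnorm, ← hSB, Multiset.map_add, Multiset.prod_add,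
      Multiset.map_congr (s := B) rfl hBz, mul_left_comm, hlead, mul_one]
  have hSne : S.toFinset.Nonempty := by
    rw [Multiset.toFinset_nonempty]
    intro h0
    rw [h0] at hcard
    exact hd hcard.symm
  obtain ⟨α, hα, hmin⟩ := S.toFinset.exists_min_image (fun α => ‖z - α‖) hSne
  rw [Multiset.mem_toFinset] at hα
  refine ⟨α, hSn α hα, (mem_roots'.1 (Multiset.mem_filter.1 hα).1).2, ?_⟩
  rw [hprod, ← hcard]
  have := Multiset.prod_map_le_prod_map₀ (s := S) (fun _ => ‖z - α‖) (fun β => ‖z - β‖)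
    (fun _ _ => norm_nonneg _) (fun β hβ => hmin β (Multiset.mem_toFinset.2 hβ))
  rwa [Multiset.map_const', Multiset.prod_replicate] at this

end PolynomialRoots

section SeriesZeros

open Filter Topology

variable {L : Type*} [NontriviallyNormedField L]

theorem exists_last_max {u : ℕ → L} (hu : Tendsto u atTop (𝓝 0)) {n : ℕ} (hn : u n ≠ 0) :
    ∃ d, (∀ i, ‖u i‖ ≤ ‖u d‖) ∧ (∀ i, d < i → ‖u i‖ < ‖u d‖) := by
  have hfin : {i | ‖u n‖ ≤ ‖u i‖}.Finite := by
    have h1 := (tendsto_zero_iff_norm_tendsto_zero.1 hu).eventually_lt_const (norm_pos_iff.2 hn)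
    rw [← Nat.cofinite_eq_atTop, eventually_cofinite] at h1
    simpa using h1
  obtain ⟨m, hm, hmax⟩ := hfin.toFinset.exists_max_image (fun i => ‖u i‖) ⟨n, by simp⟩
  have hall : ∀ i, ‖u i‖ ≤ ‖u m‖ := fun i => by
    by_cases hi : ‖u n‖ ≤ ‖u i‖
    · exact hmax i (by simpa using hi)
    · exact (not_le.1 hi).le.trans (by simpa using hm)
  have hfin' : {i | ‖u m‖ ≤ ‖u i‖}.Finite := hfin.subset fun i hi =>
    (hall n).trans hi
  obtain ⟨d, hd, hlast⟩ := hfin'.toFinset.exists_max_image id ⟨m, by simp⟩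
  have hd : ‖u m‖ ≤ ‖u d‖ := by simpa using hd
  refine ⟨d, fun i => (hall i).trans hd, fun i hi => ?_⟩
  by_contra! hge
  exact absurd (hlast i (by simpa using hd.trans hge)) (not_le.2 hi)

variable [IsUltrametricDist L]

theorem norm_sum_le_of_forall_le {ι : Type*} {s : Finset ι} {u : ι → L} {C : ℝ} (hC : 0 ≤ C)
    (h : ∀ i ∈ s, ‖u i‖ ≤ C) : ‖∑ i ∈ s, u i‖ ≤ C :=
  IsUltrametricDist.norm_sum_le_of_forall_le_of_nonneg hC h

theorem norm_pow_sub_pow_le {x y : L} {r : ℝ} (hx : ‖x‖ ≤ r) (hy : ‖y‖ ≤ r) (n : ℕ) :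
    ‖x ^ (n + 1) - y ^ (n + 1)‖ ≤ r ^ n * ‖x - y‖ := by
  have hr : 0 ≤ r := (norm_nonneg _).trans hx
  induction n with
  | zero => simp
  | succ n ih =>
    have e : x ^ (n + 1 + 1) - y ^ (n + 1 + 1) =
        x * (x ^ (n + 1) - y ^ (n + 1)) + y ^ (n + 1) * (x - y) := by ring
    rw [e]
    apply norm_add_le_of_le
    · rw [norm_mul, pow_succ' r, mul_assoc]
      gcongr
    · rw [norm_mul, norm_pow]
      gcongr

theorem summable_of_tendsto_zero [CompleteSpace L] {u : ℕ → L} (h : Tendsto u atTop (𝓝 0)) :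
    Summable u :=
  NonarchimedeanAddGroup.summable_of_tendsto_cofinite_zero (by rwa [Nat.cofinite_eq_atTop])

/-- Truncations of the series all have the same Newton index $d$. Starting from a root of one
truncation, the next truncation differs there by a single term, so it has a root nearby. The chosen
roots form a Cauchy sequence, whose limit is a zero of the series. -/
theorem exists_zero_of_norm_eq_one [CompleteSpace L] [IsAlgClosed L] {u : ℕ → L}
    (hu : Tendsto u atTop (𝓝 0)) {d : ℕ} (hd : d ≠ 0) (hle : ∀ i, ‖u i‖ ≤ 1) (heq : ‖u d‖ = 1)
    (hlt : ∀ i, d < i → ‖u i‖ < 1) : ∃ z : L, ‖z‖ ≤ 1 ∧ ∑' i, u i * z ^ i = 0 := by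
  classical
  let Q : ℕ → Polynomial L := fun N => ∑ i ∈ Finset.range (N + d + 1), Polynomial.monomial i (u i)
  have hcoeff : ∀ N i, (Q N).coeff i = if i < N + d + 1 then u i else 0 := fun N i => by
    simp only [Q, Polynomial.finsetSum_coeff, Polynomial.coeff_monomial, Finset.sum_ite_eq',
      Finset.mem_range]
  have hroot : ∀ N, ∀ z : L, ‖z‖ ≤ 1 →
      ∃ α : L, ‖α‖ ≤ 1 ∧ (Q N).eval α = 0 ∧ ‖z - α‖ ^ d ≤ ‖(Q N).eval z‖ := by
    intro N z hz
    refine exists_root_near hd (fun i => ?_) ?_ (fun i hi => ?_) hz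
    · rw [hcoeff]; split_ifs
      · exact hle i
      · simp
    · rw [hcoeff, if_pos (by omega), heq]
    · rw [hcoeff]; split_ifs
      · exact hlt i hi
      · simp
  have heval : ∀ N z, (Q N).eval z = ∑ i ∈ Finset.range (N + d + 1), u i * z ^ i := fun N z => by
    simp [Q, Polynomial.eval_finsetSum]
  choose ρ hρ1 hρ0 hρd using hroot
  let w : ℕ → {z : L // ‖z‖ ≤ 1} := fun N =>
    Nat.rec (motive := fun _ => {z : L // ‖z‖ ≤ 1}) ⟨ρ 0 0 (by simp), hρ1 _ _ _⟩
      (fun N z => ⟨ρ (N + 1) z.1 z.2, hρ1 _ _ _⟩) N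
  have hw0 : ∀ N, (Q N).eval (w N).1 = 0 := fun N => by
    cases N with
    | zero => exact hρ0 _ _ _
    | succ N => exact hρ0 _ _ _
  have hstep : ∀ N, ‖(w (N + 1)).1 - (w N).1‖ ^ d ≤ ‖u (N + 1 + d)‖ := fun N => by
    rw [norm_sub_rev]
    refine (hρd (N + 1) (w N).1 (w N).2).trans ?_
    have e : (Q (N + 1)).eval (w N).1 = u (N + 1 + d) * (w N).1 ^ (N + 1 + d) := by
      rw [heval, Finset.sum_range_succ, show N + 1 + d = N + d + 1 by ring, ← heval, hw0, zero_add]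
    rw [e, norm_mul, norm_pow]
    exact mul_le_of_le_one_right (norm_nonneg _) (pow_le_one₀ (norm_nonneg _) (w N).2)
  have hcau : CauchySeq fun N => (w N).1 := by
    apply NonarchimedeanAddGroup.cauchySeq_of_tendsto_sub_nhds_zero
    rw [Metric.tendsto_atTop]
    intro ε hε
    have hu' := (hu.comp (tendsto_add_atTop_nat (1 + d)))
    rw [Metric.tendsto_atTop] at hu'
    -- Only the $d$-th power of the distance between consecutive roots is controlled, hence the
    -- tolerance $\varepsilon^d$.
    obtain ⟨N, hN⟩ := hu' (ε ^ d) (by positivity)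
    refine ⟨N, fun n hn => ?_⟩
    rw [dist_zero_right]
    have h1 := hN n hn
    rw [dist_zero_right, Function.comp_apply, ← add_assoc] at h1
    exact lt_of_pow_lt_pow_left₀ d hε.le ((hstep n).trans_lt h1)
  obtain ⟨z, hz⟩ := cauchySeq_tendsto_of_complete hcau
  have hz1 : ‖z‖ ≤ 1 := le_of_tendsto hz.norm (Eventually.of_forall fun N => (w N).2)
  refine ⟨z, hz1, ?_⟩
  have hsum : Summable fun i => u i * z ^ i := by
    apply summable_of_tendsto_zero
    refine squeeze_zero_norm (fun i => ?_) (tendsto_zero_iff_norm_tendsto_zero.1 hu)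
    rw [norm_mul, norm_pow]
    exact mul_le_of_le_one_right (norm_nonneg _) (pow_le_one₀ (norm_nonneg _) hz1)
  have h1 : Tendsto (fun N => (Q N).eval z) atTop (𝓝 (∑' i, u i * z ^ i)) := by
    simp only [heval]
    exact hsum.hasSum.tendsto_sum_nat.comp (tendsto_add_atTop_nat (d + 1))
  have h2 : Tendsto (fun N => (Q N).eval z) atTop (𝓝 0) := by
    refine squeeze_zero_norm (fun N => ?_)
      (tendsto_zero_iff_norm_tendsto_zero.1 (tendsto_sub_nhds_zero_iff.2 hz))
    have e : (Q N).eval z = ∑ i ∈ Finset.range (N + d + 1), u i * (z ^ i - (w N).1 ^ i) := by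
      simp only [mul_sub, Finset.sum_sub_distrib, ← heval, hw0, sub_zero]
    rw [e, norm_sub_rev]
    refine norm_sum_le_of_forall_le (norm_nonneg _) fun i _ => ?_
    rw [norm_mul]
    refine (mul_le_of_le_one_left (norm_nonneg _) (hle i)).trans ?_
    cases i with
    | zero => simp
    | succ i => simpa using norm_pow_sub_pow_le hz1 (w N).2 i
  exact tendsto_nhds_unique h1 h2

/-- Over a complete algebraically closed field, a power series that converges on the closed unit
ball and whose constant term does not dominate all other coefficients has a zero in this ball. -/
theorem exists_zero_of_norm_le [CompleteSpace L] [IsAlgClosed L] {u : ℕ → L}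
    (hu : Tendsto u atTop (𝓝 0)) {n : ℕ} (hn : n ≠ 0) (hun : u n ≠ 0) (h0 : ‖u 0‖ ≤ ‖u n‖) :
    ∃ z : L, ‖z‖ ≤ 1 ∧ ∑' i, u i * z ^ i = 0 := by
  obtain ⟨d, hle, hlt⟩ := exists_last_max hu hun
  have hud : u d ≠ 0 := norm_pos_iff.1 ((norm_pos_iff.2 hun).trans_le (hle n))
  have hd0 : 0 < ‖u d‖ := norm_pos_iff.2 hud
  -- Index 0 cannot be the last maximum, because the coefficient at $n>0$ is at least as large as
  -- the constant term.
  have hd : d ≠ 0 := by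
    rintro rfl
    exact absurd (hlt n (Nat.pos_of_ne_zero hn)) (not_lt.2 h0)
  obtain ⟨z, hz, hs⟩ := exists_zero_of_norm_eq_one (u := fun i => (u d)⁻¹ * u i)
    (by simpa using hu.const_mul (u d)⁻¹) hd
    (fun i => by
      rw [norm_mul, norm_inv, inv_mul_le_one₀ hd0]
      exact hle i)
    (by rw [inv_mul_cancel₀ hud, norm_one])
    (fun i hi => by
      rw [norm_mul, norm_inv, inv_mul_lt_one₀ hd0]
      exact hlt i hi)
  refine ⟨z, hz, ?_⟩
  simp only [mul_assoc] at hs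
  rw [tsum_mul_left] at hs
  exact (mul_eq_zero.1 hs).resolve_left (inv_ne_zero hud)

end SeriesZeros

/-! ### Power series on closed balls -/

section Values

open Filter Topology

variable {K : Type*} [NontriviallyNormedField K] {M : Type*} [NontriviallyNormedField M]
  [NormedAlgebra K M]

theorem norm_term (F : PowerSeries K) (y : M) (n : ℕ) :
    ‖term F y n‖ = ‖PowerSeries.coeff n F‖ * ‖y‖ ^ n := by
  rw [term, norm_mul, norm_algebraMap', norm_pow]

theorem term_zero_eq {F : PowerSeries K} (h0 : PowerSeries.coeff 0 F = 0) (n : ℕ) :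
    term F (0 : M) n = 0 := by
  cases n with
  | zero => simp [term, h0]
  | succ n => simp [term]

theorem value_zero {F : PowerSeries K} (h0 : PowerSeries.coeff 0 F = 0) :
    value F (0 : M) = 0 := by
  simp [value, term_zero_eq h0]

theorem value_algebraMap {F : PowerSeries K} {y : K} (h : ConvergesAt F y) :
    value F (algebraMap K M y) = algebraMap K M (value F y) := by
  have h1 := (Summable.hasSum h).map (algebraMap K M) (algebraMap_isometry K M).continuous
  refine Eq.trans ?_ h1.tsum_eq
  rw [value]
  congr 1
  funext n
  simp [term]

/-- The terms tend to 0, so their supremum is attained; termwise strict inequality thus becomes a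
bound by a single $\theta<1$. -/
theorem exists_uniform_bound {F : PowerSeries K} {s : M} (hs : ConvergesAt F s) (hs0 : s ≠ 0)
    (hF : ∀ n, ‖PowerSeries.coeff (n + 2) F‖ * ‖s‖ ^ (n + 1) < 1) :
    ∃ θ, 0 ≤ θ ∧ θ < 1 ∧ ∀ n, ‖PowerSeries.coeff (n + 2) F‖ * ‖s‖ ^ (n + 1) ≤ θ := by
  by_cases h0 : ∀ n, PowerSeries.coeff (n + 2) F = 0
  · exact ⟨0, le_rfl, one_pos, fun n => by simp [h0 n]⟩
  push Not at h0
  obtain ⟨n, hn⟩ := h0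
  let u : ℕ → M := fun n => term F s (n + 2) * s⁻¹
  have hnorm : ∀ n, ‖u n‖ = ‖PowerSeries.coeff (n + 2) F‖ * ‖s‖ ^ (n + 1) := fun n => by
    have : ‖s‖ ≠ 0 := norm_ne_zero_iff.2 hs0
    simp only [u]
    rw [norm_mul, norm_term, norm_inv, pow_succ _ (n + 1), mul_assoc, mul_assoc,
      mul_inv_cancel₀ this, mul_one]
  have hu : Tendsto u atTop (𝓝 0) := by
    have := ((Summable.tendsto_atTop_zero hs).comp (tendsto_add_atTop_nat 2)).mul_const s⁻¹
    rwa [zero_mul] at this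
  have hun : u n ≠ 0 := by
    rw [← norm_ne_zero_iff, hnorm]
    have := norm_ne_zero_iff.2 hs0
    exact mul_ne_zero (norm_ne_zero_iff.2 hn) (pow_ne_zero _ this)
  obtain ⟨d, hd, -⟩ := exists_last_max hu hun
  refine ⟨‖u d‖, norm_nonneg _, by rw [hnorm]; exact hF d, fun m => ?_⟩
  rw [← hnorm]
  exact hd m

variable [IsUltrametricDist M]

/-- Each difference $x^{n+2}-y^{n+2}$ is divisible by $x-y$ with a cofactor of norm at most
$r^{n+1}$. With $\theta<1$ and a linear coefficient of norm 1 this makes the series an isometry. -/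
theorem norm_value_sub_le {F : PowerSeries K} {r θ : ℝ} (hθ : 0 ≤ θ)
    (hF : ∀ n, ‖PowerSeries.coeff (n + 2) F‖ * r ^ (n + 1) ≤ θ) {x y : M} (hx : ‖x‖ ≤ r)
    (hy : ‖y‖ ≤ r) (hFx : ConvergesAt F x) (hFy : ConvergesAt F y) :
    ‖value F x - value F y - algebraMap K M (PowerSeries.coeff 1 F) * (x - y)‖ ≤ θ * ‖x - y‖ := by
  have hs : Summable fun n => term F x n - term F y n := Summable.sub hFx hFy
  have e : value F x - value F y - algebraMap K M (PowerSeries.coeff 1 F) * (x - y) =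
      ∑' n, (term F x (n + 2) - term F y (n + 2)) := by
    rw [value, value, ← Summable.tsum_sub hFx hFy, ← hs.sum_add_tsum_nat_add 2]
    simp [Finset.sum_range_succ, term]
    ring
  rw [e]
  refine IsUltrametricDist.norm_tsum_le_of_forall_le_of_nonneg (by positivity) fun n => ?_
  rw [term, term, ← mul_sub, norm_mul, norm_algebraMap']
  calc _ ≤ ‖PowerSeries.coeff (n + 2) F‖ * (r ^ (n + 1) * ‖x - y‖) := by
        gcongr
        exact norm_pow_sub_pow_le hx hy (n + 1)
    _ = ‖PowerSeries.coeff (n + 2) F‖ * r ^ (n + 1) * ‖x - y‖ := by ring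
    _ ≤ θ * ‖x - y‖ := by gcongr; exact hF n

variable [CompleteSpace M]

theorem ConvergesAt.of_norm_le {M' : Type*} [NontriviallyNormedField M'] [NormedAlgebra K M']
    {F : PowerSeries K} {s : M'} (h : ConvergesAt F s) {y : M} (hy : ‖y‖ ≤ ‖s‖) :
    ConvergesAt F y := by
  apply summable_of_tendsto_zero
  refine squeeze_zero_norm (fun n => ?_)
    (tendsto_zero_iff_norm_tendsto_zero.1 (Summable.tendsto_atTop_zero h))
  rw [norm_term, norm_term]
  gcongr

/-- The equation $F(y)=w$ is the fixed-point equation of the contraction $y\mapsto w-(F(y)-y)$. This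
requires completeness only, so it provides preimages in $K$ itself and not merely in $L$. -/
theorem exists_value_eq {F : PowerSeries K} {s : M} (hs : ConvergesAt F s)
    (h0 : PowerSeries.coeff 0 F = 0) (h1 : PowerSeries.coeff 1 F = 1) {θ : ℝ} (hθ : 0 ≤ θ)
    (hθ1 : θ < 1) (hF : ∀ n, ‖PowerSeries.coeff (n + 2) F‖ * ‖s‖ ^ (n + 1) ≤ θ) {w : M}
    (hw : ‖w‖ ≤ ‖s‖) : ∃ y : M, ‖y‖ ≤ ‖s‖ ∧ value F y = w := by
  have hconv : ∀ y : M, ‖y‖ ≤ ‖s‖ → ConvergesAt F y := fun y hy => hs.of_norm_le hy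
  have hdiff : ∀ x y : M, ‖x‖ ≤ ‖s‖ → ‖y‖ ≤ ‖s‖ →
      ‖value F x - value F y - (x - y)‖ ≤ θ * ‖x - y‖ := fun x y hx hy => by
    simpa [h1] using norm_value_sub_le hθ hF hx hy (hconv x hx) (hconv y hy)
  let φ : M → M := fun y => w - (value F y - y)
  have hmaps : Set.MapsTo φ (Metric.closedBall 0 ‖s‖) (Metric.closedBall 0 ‖s‖) := by
    intro y hy
    rw [mem_closedBall_zero_iff] at hy ⊢
    refine norm_sub_le_of_le hw ?_
    have := hdiff y 0 hy (by simp)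
    rw [value_zero h0, sub_zero, sub_zero] at this
    exact this.trans ((mul_le_of_le_one_left (norm_nonneg _) hθ1.le).trans hy)
  have hcontr : ContractingWith ⟨θ, hθ⟩ (hmaps.restrict φ _ _) := by
    refine ⟨by exact_mod_cast hθ1, LipschitzWith.of_dist_le_mul fun x y => ?_⟩
    have := hdiff y x (mem_closedBall_zero_iff.1 y.2) (mem_closedBall_zero_iff.1 x.2)
    rw [Subtype.dist_eq, Subtype.dist_eq, dist_eq_norm, dist_eq_norm, norm_sub_rev (x : M)]
    refine le_trans (le_of_eq ?_) this
    congr 1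
    simp only [φ, Set.MapsTo.val_restrict_apply]
    ring
  obtain ⟨y, hy, hfix, -⟩ := hcontr.exists_fixedPoint' Metric.isClosed_closedBall.isComplete
    hmaps (x := 0) (by simp) (edist_ne_top _ _)
  refine ⟨y, by simpa using hy, ?_⟩
  have : w - (value F y - y) = y := hfix
  linear_combination -this

/-- If a power series is one-to-one on a closed ball over an algebraically closed complete field,
then its linear term dominates all its terms of higher degree on this ball. -/
theorem norm_coeff_mul_pow_lt_one [IsAlgClosed M] {F : PowerSeries K} {s : M}
    (hs : ConvergesAt F s) (hs0 : s ≠ 0) (h0 : PowerSeries.coeff 0 F = 0)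
    (h1 : ‖PowerSeries.coeff 1 F‖ = 1)
    (hinj : Set.InjOn (fun y : M => value F y) (Metric.closedBall 0 ‖s‖)) (n : ℕ) :
    ‖PowerSeries.coeff (n + 2) F‖ * ‖s‖ ^ (n + 1) < 1 := by
  by_contra! hge
  -- These are chosen so that $F(sz)=sz\sum u_iz^i$; a zero of the second factor is a second zero of
  -- $F$ in the ball.
  let u : ℕ → M := fun i => algebraMap K M (PowerSeries.coeff (i + 1) F) * s ^ i
  have hus : ∀ i, u i * s = term F s (i + 1) := fun i => by
    simp only [u, term, pow_succ]
    ring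
  have hu : Tendsto u atTop (𝓝 0) := by
    have := ((Summable.tendsto_atTop_zero hs).comp (tendsto_add_atTop_nat 1)).mul_const s⁻¹
    rw [zero_mul] at this
    refine this.congr fun i => ?_
    rw [Function.comp_apply, ← hus, mul_inv_cancel_right₀ hs0]
  have hnorm : ∀ i, ‖u i‖ = ‖PowerSeries.coeff (i + 1) F‖ * ‖s‖ ^ i := fun i => by
    rw [norm_mul, norm_algebraMap', norm_pow]
  have hu0 : ‖u 0‖ = 1 := by rw [hnorm, pow_zero, mul_one, h1]
  have hun : 1 ≤ ‖u (n + 1)‖ := by rwa [hnorm]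
  obtain ⟨z, hz, hsum⟩ := exists_zero_of_norm_le hu n.succ_ne_zero
    (norm_pos_iff.1 (one_pos.trans_le hun)) (hu0.trans_le hun)
  have hsz : ‖s * z‖ ≤ ‖s‖ := by
    rw [norm_mul]
    exact mul_le_of_le_one_right (norm_nonneg _) hz
  have hval : value F (s * z) = 0 := by
    have hconv : Summable (term F (s * z)) := hs.of_norm_le hsz
    rw [value, hconv.tsum_eq_zero_add]
    have e : ∀ i, term F (s * z) (i + 1) = s * z * (u i * z ^ i) := fun i => by
      simp only [u, term, pow_succ, mul_pow]
      ring
    simp only [e, tsum_mul_left, hsum, mul_zero, add_zero]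
    simp [term, h0]
  have hsz0 : s * z = 0 := hinj (by simpa using hsz) (by simp) (by simp [hval, value_zero h0])
  have hz0 : z = 0 := (mul_eq_zero.1 hsz0).resolve_left hs0
  rw [hz0, tsum_eq_single 0 (fun i hi => by simp [hi])] at hsum
  simp only [pow_zero, mul_one] at hsum
  rw [hsum] at hu0
  simp at hu0

end Values

/-! ### The conjugacy between a linearization sphere and the unit sphere -/

section Discs

variable {X : Type*} [PseudoMetricSpace X] {x₀ : X} {U : Set X}

theorem IsDiscAbout.closedBall_subset (hU : IsDiscAbout x₀ U) {x : X} (hx : x ∈ U) :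
    Metric.closedBall x₀ (dist x x₀) ⊆ U := by
  rcases hU with rfl | ⟨R, -, rfl | rfl⟩
  · exact Set.subset_univ _
  · exact Metric.closedBall_subset_ball hx
  · exact Metric.closedBall_subset_closedBall hx

end Discs

section Linearization

variable {K : Type*} [NontriviallyNormedField K] {L : Type*} [NontriviallyNormedField L]
  [NormedAlgebra K L] {F G : PowerSeries K}

theorem LinearizesOn.mono {x₀ : L} {U V : Set L} (h : LinearizesOn F G x₀ V) (hUV : U ⊆ V) :
    LinearizesOn F G x₀ U :=
  ⟨fun x hx => h.conv_f x (hUV hx), fun x hx => h.conv_g x (hUV hx),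
    fun x hx => h.conv_comp x (hUV hx), fun x hx => h.schroeder x (hUV hx), h.injOn.mono hUV⟩

theorem LinearizesOn.injOn_value_right {x₀ : L} {r : ℝ}
    (h : LinearizesOn F G x₀ (Metric.closedBall x₀ r)) :
    Set.InjOn (fun y : L => value G y) (Metric.closedBall 0 r) := by
  intro y hy z hz hyz
  have hmem : ∀ w : L, w ∈ Metric.closedBall (0 : L) r → w + x₀ ∈ Metric.closedBall x₀ r :=
    fun w hw => by simpa using hw
  have := h.injOn (hmem y hy) (hmem z hz) (by simpa using hyz)
  simpa using this

/-- If $f(y)=f(z)$, then $\lambda g(y)=\lambda g(z)$ by the Schröder equation, and $g$ is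
one-to-one. -/
theorem LinearizesOn.injOn_value_left {x₀ : L} {r : ℝ}
    (h : LinearizesOn F G x₀ (Metric.closedBall x₀ r)) (h1 : ‖PowerSeries.coeff 1 F‖ = 1) :
    Set.InjOn (fun y : L => value F y) (Metric.closedBall 0 r) := by
  intro y hy z hz hyz
  have hmem : ∀ w : L, w ∈ Metric.closedBall (0 : L) r → w + x₀ ∈ Metric.closedBall x₀ r :=
    fun w hw => by simpa using hw
  have hlam : algebraMap K L (PowerSeries.coeff 1 F) ≠ 0 := by
    rw [← norm_ne_zero_iff, norm_algebraMap', h1]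
    exact one_ne_zero
  have ey := h.schroeder _ (hmem y hy)
  have ez := h.schroeder _ (hmem z hz)
  rw [add_sub_cancel_right] at ey ez
  have hyz : value F y = value F z := hyz
  rw [hyz, ez] at ey
  exact h.injOn_value_right hy hz (mul_left_cancel₀ hlam ey.symm)

variable [IsUltrametricDist K] [CompleteSpace K] [IsUltrametricDist L] [CompleteSpace L]
  [IsAlgClosed L]

/-- On a sphere inside the linearization disc, `f` is conjugate to the rotation of the unit sphere
by its multiplier. -/
theorem exists_homeomorph_unitSphere {f : K → K} {x₀ : K} {U : Set K} {Δ : Set L}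
    (hf : HolomorphicWithFixedPoint f x₀ F U) (hΔ : IsLinearizationDisc F x₀ Δ)
    (hΔU : restrictDisc K Δ ⊆ U) {r : ℝ} (hr : 0 < r) (hne : (Metric.sphere x₀ r).Nonempty)
    (hsub : Metric.sphere x₀ r ⊆ restrictDisc K Δ) :
    ∃ (hS : Set.MapsTo f (Metric.sphere x₀ r) (Metric.sphere x₀ r))
      (Φ : Metric.sphere x₀ r ≃ₜ Metric.sphere (0 : K) 1) (lam : Metric.sphere (0 : K) 1),
      (lam : K) = PowerSeries.coeff 1 F ∧ ∀ x, Φ (hS.restrict f _ _ x) = lam * Φ x := by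
  obtain ⟨x₁, hx₁⟩ := hne
  obtain ⟨s, hs⟩ : ∃ s, s = x₁ - x₀ := ⟨_, rfl⟩
  have hsr : ‖s‖ = r := by rw [hs, ← dist_eq_norm]; exact hx₁
  have hs0 : s ≠ 0 := norm_pos_iff.1 (hsr ▸ hr)
  obtain ⟨G, hG, ⟨hdisc, hlinΔ⟩, -⟩ := hΔ.greatest
  have hlin : LinearizesOn F G (algebraMap K L x₀) (Metric.closedBall (algebraMap K L x₀) r) := by
    refine hlinΔ.mono ?_
    have := hdisc.closedBall_subset (hsub hx₁)
    rwa [(algebraMap_isometry K L).dist_eq, show dist x₁ x₀ = r from hx₁] at this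
  have hsL : ‖algebraMap K L s‖ = r := by rw [norm_algebraMap', hsr]
  have hsL0 : algebraMap K L s ≠ 0 := by simpa using hs0
  have hmem : ∀ x ∈ Metric.closedBall x₀ r,
      algebraMap K L x ∈ Metric.closedBall (algebraMap K L x₀) r := fun x hx => by
    rw [Metric.mem_closedBall, (algebraMap_isometry K L).dist_eq]
    exact hx
  have hsub' : algebraMap K L x₁ - algebraMap K L x₀ = algebraMap K L s := by rw [hs, map_sub]
  have hFs : ConvergesAt F (algebraMap K L s) :=
    hsub' ▸ hlin.conv_f _ (hmem x₁ (Metric.sphere_subset_closedBall hx₁))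
  have hGs : ConvergesAt G (algebraMap K L s) :=
    hsub' ▸ hlin.conv_g _ (hmem x₁ (Metric.sphere_subset_closedBall hx₁))
  have hlam := hΔ.indifferent
  have hF2 := norm_coeff_mul_pow_lt_one hFs hsL0 hΔ.coeff_zero hlam
    (by rw [hsL]; exact hlin.injOn_value_left hlam)
  have hG2 := norm_coeff_mul_pow_lt_one hGs hsL0 hG.coeff_zero (by rw [hG.coeff_one, norm_one])
    (by rw [hsL]; exact hlin.injOn_value_right)
  obtain ⟨θ, hθ0, hθ1, hFθ⟩ := exists_uniform_bound hFs hsL0 hF2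
  obtain ⟨η, hη0, hη1, hGη⟩ := exists_uniform_bound hGs hsL0 hG2
  rw [hsL] at hFθ hGη
  have hFK : ∀ y : K, ‖y‖ ≤ r → ConvergesAt F y := fun y hy => hFs.of_norm_le (by rwa [hsL])
  have hGK : ∀ y : K, ‖y‖ ≤ r → ConvergesAt G y := fun y hy => hGs.of_norm_le (by rwa [hsL])
  have hGiso : ∀ x y : K, ‖x‖ ≤ r → ‖y‖ ≤ r → ‖value G x - value G y‖ = ‖x - y‖ := by
    intro x y hx hy
    rcases eq_or_ne x y with rfl | hxy
    · simp
    have hpos : 0 < ‖x - y‖ := norm_pos_iff.2 (sub_ne_zero.2 hxy)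
    apply norm_eq_of_norm_sub_lt
    have := norm_value_sub_le hη0 hGη hx hy (hGK x hx) (hGK y hy)
    rw [hG.coeff_one, map_one, one_mul] at this
    exact this.trans_lt (by nlinarith)
  have hGnorm : ∀ x : K, ‖x‖ ≤ r → ‖value G x‖ = ‖x‖ := fun x hx => by
    simpa [value_zero hG.coeff_zero] using hGiso x 0 hx (by simpa using hr.le)
  have hFnorm : ∀ x : K, ‖x‖ = r → ‖value F x‖ = r := by
    intro x hx
    have h1 : ‖PowerSeries.coeff 1 F * x‖ = r := by rw [norm_mul, hlam, one_mul, hx]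
    rw [← h1]
    apply norm_eq_of_norm_sub_lt
    have := norm_value_sub_le hθ0 hFθ hx.le (y := (0 : K)) (by simpa using hr.le) (hFK x hx.le)
      (hFK 0 (by simpa using hr.le))
    rw [value_zero hΔ.coeff_zero, sub_zero, sub_zero, hx] at this
    rw [h1]
    exact this.trans_lt (by nlinarith)
  have hfval : ∀ x ∈ Metric.sphere x₀ r, f x - x₀ = value F (x - x₀) := fun x hx =>
    (hf.expansion x (hΔU (hsub hx))).tsum_eq.symm
  have hnorm : ∀ x ∈ Metric.sphere x₀ r, ‖x - x₀‖ = r := fun x hx => by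
    rw [← dist_eq_norm]; exact hx
  have hS : Set.MapsTo f (Metric.sphere x₀ r) (Metric.sphere x₀ r) := fun x hx => by
    rw [Metric.mem_sphere, dist_eq_norm, hfval x hx]
    exact hFnorm _ (hnorm x hx)
  -- Division by $s$, a difference of two points of $K$ with norm exactly $r$, rescales to the unit
  -- sphere; a non-empty sphere supplies such an $s$.
  let φ : Metric.sphere x₀ r → Metric.sphere (0 : K) 1 := fun x =>
    ⟨value G (x.1 - x₀) / s, by
      rw [mem_sphere_zero_iff_norm, norm_div, hGnorm _ (hnorm x x.2).le, hnorm x x.2, hsr,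
        div_self hr.ne']⟩
  have hφdist : ∀ x y, dist (φ x) (φ y) = dist x y / r := fun x y => by
    rw [Subtype.dist_eq, Subtype.dist_eq, dist_eq_norm, dist_eq_norm]
    simp only [φ]
    rw [← sub_div, norm_div, hsr, hGiso _ _ (hnorm x x.2).le (hnorm y y.2).le,
      sub_sub_sub_cancel_right]
  have hφind : Topology.IsInducing φ := by
    have hl : LipschitzWith (Real.toNNReal r⁻¹) φ := LipschitzWith.of_dist_le_mul fun x y => by
      rw [hφdist, Real.coe_toNNReal _ (inv_pos.2 hr).le, div_eq_inv_mul]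
    have ha : AntilipschitzWith (Real.toNNReal r) φ := AntilipschitzWith.of_le_mul_dist fun x y => by
      rw [hφdist, Real.coe_toNNReal _ hr.le, mul_div_cancel₀ _ hr.ne']
    exact (ha.isUniformInducing hl.uniformContinuous).isInducing
  have hφbij : Function.Bijective φ := by
    constructor
    · intro x y hxy
      have := hφdist x y
      rw [hxy, dist_self, eq_comm, div_eq_zero_iff] at this
      exact dist_eq_zero.1 (this.resolve_right hr.ne')
    · intro w
      have hw : ‖(w : K)‖ = 1 := by simp
      have hsK : ConvergesAt G s := hGK s hsr.le
      obtain ⟨y, hy, hyw⟩ := exists_value_eq hsK hG.coeff_zero hG.coeff_one hη0 hη1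
        (by rwa [hsr]) (w := w * s) (by rw [norm_mul, hw, one_mul])
      have hyr : ‖y‖ = r := by
        rw [← hGnorm y (hsr ▸ hy), hyw, norm_mul, hw, one_mul, hsr]
      refine ⟨⟨y + x₀, by simpa using hyr⟩, Subtype.ext ?_⟩
      simp only [φ, add_sub_cancel_right]
      rw [hyw, mul_div_cancel_right₀ _ hs0]
  refine ⟨hS, (Equiv.ofBijective φ hφbij).toHomeomorphOfIsInducing hφind,
    ⟨PowerSeries.coeff 1 F, by simpa using hlam⟩, rfl, fun x => Subtype.ext ?_⟩
  change value G (f x - x₀) / s = PowerSeries.coeff 1 F * (value G (x.1 - x₀) / s)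
  rw [← mul_div_assoc]
  congr 1
  -- The Schröder equation is given over $L$; all values involved lie in $K$, so it descends.
  apply (algebraMap K L).injective
  have hsch := hlin.schroeder _ (hmem x (Metric.sphere_subset_closedBall x.2))
  rw [← map_sub, value_algebraMap (hFK _ (hnorm x x.2).le), ← hfval x x.2,
    value_algebraMap (hGK _ (hnorm _ (hS x.2)).le), value_algebraMap (hGK _ (hnorm x x.2).le),
    ← map_mul] at hsch
  exact hsch

end Linearization

/-! ### Generators of the units modulo `p²` -/

section LiftingExponent

variable {K : Type*} [NormedField K] [IsUltrametricDist K] {p : ℕ}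

/-- The term $px$ dominates: the quadratic term gains a factor $p$ because $p\mid\binom p2$ for odd
$p$, and the cubic remainder is small because $|x|\le|p|$. -/
theorem norm_one_add_pow_prime_sub_one (hp : p.Prime) (hp2 : p ≠ 2) (hp0 : (p : K) ≠ 0)
    (hp1 : ‖(p : K)‖ < 1) {x : K} (hx : ‖x‖ ≤ ‖(p : K)‖) :
    ‖(1 + x) ^ p - 1‖ = ‖(p : K)‖ * ‖x‖ := by
  rcases eq_or_ne x 0 with rfl | hx0
  · simp
  have hxp : 0 < ‖x‖ := norm_pos_iff.2 hx0
  have hpp : 0 < ‖(p : K)‖ := norm_pos_iff.2 hp0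
  have hx1 : ‖x‖ < 1 := hx.trans_lt hp1
  obtain ⟨c, hc, e⟩ := one_add_pow_eq hx1.le p
  rw [← norm_mul]
  apply norm_eq_of_norm_sub_lt
  have e' : (1 + x) ^ p - 1 - p * x = (p.choose 2 : ℕ) * x ^ 2 + c * x ^ 3 := by rw [e]; ring
  rw [e']
  apply norm_add_lt_of_lt
  · have hd : p ∣ p.choose 2 := hp.dvd_choose_self two_ne_zero (lt_of_le_of_ne hp.two_le hp2.symm)
    rw [norm_mul, norm_mul, norm_pow]
    calc _ ≤ ‖(p : K)‖ * ‖x‖ ^ 2 := by gcongr; exact norm_natCast_le_of_dvd hd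
      _ = ‖(p : K)‖ * ‖x‖ * ‖x‖ := by ring
      _ < ‖(p : K)‖ * ‖x‖ * 1 := by gcongr
      _ = _ := mul_one _
  · rw [norm_mul, norm_mul, norm_pow]
    calc _ ≤ 1 * ‖x‖ ^ 3 := by gcongr
      _ = ‖x‖ * ‖x‖ * ‖x‖ := by ring
      _ ≤ ‖(p : K)‖ * ‖x‖ * ‖x‖ := by gcongr
      _ < ‖(p : K)‖ * ‖x‖ * 1 := by gcongr
      _ = _ := mul_one _

/-- Lifting the exponent. -/
theorem norm_one_add_pow_sub_one (hp : p.Prime) (hp2 : p ≠ 2) (hp0 : (p : K) ≠ 0)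
    (hp1 : ‖(p : K)‖ < 1) {x : K} (hx : ‖x‖ ≤ ‖(p : K)‖) (n : ℕ) :
    ‖(1 + x) ^ n - 1‖ = ‖(n : K)‖ * ‖x‖ := by
  induction n using Nat.strong_induction_on generalizing x with
  | _ n ih =>
    rcases Nat.eq_zero_or_pos n with rfl | hn
    · simp
    rcases eq_or_ne x 0 with rfl | hx0
    · simp
    have hxp : 0 < ‖x‖ := norm_pos_iff.2 hx0
    have hx1 : ‖x‖ < 1 := hx.trans_lt hp1
    by_cases hd : p ∣ n
    · obtain ⟨m, rfl⟩ := hd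
      have h1 := norm_one_add_pow_prime_sub_one hp hp2 hp0 hp1 hx
      -- The factor $p$ of the exponent is absorbed by replacing $1+x$ with $(1+x)^p$, which is even
      -- closer to 1.
      have h2 := ih m (by nlinarith [hp.one_lt, Nat.pos_of_mul_pos_left hn])
        (x := (1 + x) ^ p - 1) (by rw [h1]; exact mul_le_of_le_one_right (norm_nonneg _) hx1.le)
      rw [add_sub_cancel, ← pow_mul, h1] at h2
      rw [h2, Nat.cast_mul, norm_mul]
      ring
    · have hn1 : ‖(n : K)‖ = 1 := le_antisymm (norm_natCast_le_one' _)
        (not_lt.1 fun h => hd (dvd_of_norm_natCast_lt_one hp hp1 h))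
      obtain ⟨c, hc, e⟩ := one_add_pow_eq hx1.le n
      rw [← norm_mul]
      apply norm_eq_of_norm_sub_lt
      have e' : (1 + x) ^ n - 1 - n * x = ((n.choose 2 : ℕ) + c * x) * x ^ 2 := by rw [e]; ring
      rw [e', norm_mul, norm_mul, norm_pow, hn1, one_mul]
      have h3 : ‖((n.choose 2 : ℕ) : K) + c * x‖ ≤ 1 := by
        refine norm_add_le_of_le (norm_natCast_le_one' _) ?_
        rw [norm_mul]
        exact mul_le_one₀ hc (norm_nonneg _) hx1.le
      nlinarith

end LiftingExponent

section PadicGenerator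

variable {p : ℕ} [hp : Fact p.Prime]

theorem padic_norm_prime_pos : 0 < ‖(p : ℚ_[p])‖ :=
  norm_pos_iff.2 (by exact_mod_cast hp.out.ne_zero)

theorem padic_prime_ne_zero : (p : ℚ_[p]) ≠ 0 := norm_pos_iff.1 padic_norm_prime_pos

theorem padic_norm_le_of_lt_one {x : ℚ_[p]} (hx : ‖x‖ < 1) : ‖x‖ ≤ ‖(p : ℚ_[p])‖ := by
  obtain ⟨y, hy⟩ := (PadicInt.norm_lt_one_iff_dvd (⟨x, hx.le⟩ : ℤ_[p])).1 hx
  have hxy : x = p * y := by exact_mod_cast congrArg Subtype.val hy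
  rw [hxy, norm_mul]
  exact mul_le_of_le_one_right (norm_nonneg _) y.2

theorem padic_norm_le_sq_of_lt {x : ℚ_[p]} (hx : ‖x‖ < ‖(p : ℚ_[p])‖) :
    ‖x‖ ≤ ‖(p : ℚ_[p])‖ ^ 2 := by
  have hpp := padic_norm_prime_pos (p := p)
  have := padic_norm_le_of_lt_one (x := x / (p : ℚ_[p])) (by rwa [norm_div, div_lt_one hpp])
  rwa [norm_div, div_le_iff₀ hpp, ← pow_two] at this

theorem toZModPow_two_eq_zero_iff (y : ℤ_[p]) :
    PadicInt.toZModPow 2 y = 0 ↔ ‖(y : ℚ_[p])‖ ≤ ‖(p : ℚ_[p])‖ ^ 2 := by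
  rw [← RingHom.mem_ker, PadicInt.ker_toZModPow, ← PadicInt.norm_le_pow_iff_mem_span_pow,
    PadicInt.norm_def, Padic.norm_p]
  simp

theorem exists_natCast_padic_norm_le {x : ℚ_[p]} (hx : ‖x‖ ≤ 1) :
    ∃ n : ℕ, ‖x - n‖ ≤ ‖(p : ℚ_[p])‖ := by
  obtain ⟨y, rfl⟩ : ∃ y : ℤ_[p], (y : ℚ_[p]) = x := ⟨⟨x, hx⟩, rfl⟩
  refine ⟨y.zmodRepr, padic_norm_le_of_lt_one ?_⟩
  have := PadicInt.norm_sub_zmodRepr_lt_one y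
  rwa [PadicInt.norm_def, PadicInt.coe_sub, PadicInt.coe_natCast] at this

namespace GeneratesUnitsModSq

variable {lam : ℚ_[p]}

theorem norm_eq_one (h : GeneratesUnitsModSq p lam) : ‖lam‖ = 1 := by
  obtain ⟨z, u, rfl, hu, -⟩ := h
  refine le_antisymm z.2 (not_lt.1 fun hlt => ?_)
  have h2 : PadicInt.toZModPow 2 (z ^ 2) = 0 := by
    rw [toZModPow_two_eq_zero_iff]
    push_cast
    rw [norm_pow]
    gcongr
    exact padic_norm_le_of_lt_one hlt
  rw [map_pow, hu] at h2
  have h3 : IsUnit ((u : ZMod (p ^ 2)) ^ 2) := u.isUnit.pow 2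
  have : Fact (1 < p ^ 2) := ⟨Nat.one_lt_pow two_ne_zero hp.out.one_lt⟩
  exact h3.ne_zero h2

/-- A generator of $(\mathbb{Z}/p^2\mathbb{Z})^*$ has order $\varphi(p^2)=p(p-1)$. -/
theorem norm_pow_sub_one_le_iff (h : GeneratesUnitsModSq p lam) (n : ℕ) :
    ‖lam ^ n - 1‖ ≤ ‖(p : ℚ_[p])‖ ^ 2 ↔ p * (p - 1) ∣ n := by
  obtain ⟨z, u, rfl, hu, hgen⟩ := h
  have hne : NeZero (p ^ 2) := ⟨pow_ne_zero 2 hp.out.ne_zero⟩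
  have hord : orderOf u = p * (p - 1) := by
    rw [orderOf_eq_card_of_zpowers_eq_top hgen, Nat.card_eq_fintype_card,
      ZMod.card_units_eq_totient, Nat.totient_prime_pow hp.out two_pos,
      show 2 - 1 = 1 from rfl, pow_one]
  have e : (z : ℚ_[p]) ^ n - 1 = ((z ^ n - 1 : ℤ_[p]) : ℚ_[p]) := by push_cast; rfl
  rw [e, ← toZModPow_two_eq_zero_iff, map_sub, map_pow, map_one, hu, sub_eq_zero, ← hord,
    orderOf_dvd_iff_pow_eq_one, Units.ext_iff, Units.val_pow_eq_pow_val, Units.val_one]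

/-- If $\lambda^n\equiv 1$ modulo $p$, then $\lambda^{np}\equiv 1$ modulo $p^2$, so $p(p-1)$ divides
$np$. -/
theorem dvd_of_norm_pow_sub_one_lt (h : GeneratesUnitsModSq p lam) (hp2 : p ≠ 2) {n : ℕ}
    (hn : ‖lam ^ n - 1‖ < 1) : p - 1 ∣ n := by
  have h1 := padic_norm_le_of_lt_one hn
  have h2 := norm_one_add_pow_prime_sub_one hp.out hp2 padic_prime_ne_zero Padic.norm_p_lt_one h1
  rw [add_sub_cancel, ← pow_mul] at h2
  have h3 := (h.norm_pow_sub_one_le_iff (n * p)).1 (by rw [h2, pow_two]; gcongr)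
  rw [mul_comm n] at h3
  exact Nat.dvd_of_mul_dvd_mul_left hp.out.pos h3

theorem norm_pow_sub_one_of_not_dvd (h : GeneratesUnitsModSq p lam) (hp2 : p ≠ 2) {n : ℕ}
    (hn : ¬ p - 1 ∣ n) : ‖lam ^ n - 1‖ = 1 := by
  refine le_antisymm (norm_sub_le_of_le ?_ (by simp)) (not_lt.1 fun hlt =>
    hn (h.dvd_of_norm_pow_sub_one_lt hp2 hlt))
  rw [norm_pow, h.norm_eq_one, one_pow]

/-- Fermat's little theorem gives a norm less than 1. A norm below $|p|$ would make $p(p-1)$ divide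
$p-1$. -/
theorem norm_pow_pred_sub_one (h : GeneratesUnitsModSq p lam) :
    ‖lam ^ (p - 1) - 1‖ = ‖(p : ℚ_[p])‖ := by
  have h1 : ‖lam ^ (p - 1) - 1‖ < 1 := by
    have hn := h.norm_eq_one
    obtain ⟨z, u, rfl, hu, -⟩ := h
    have e : (z : ℚ_[p]) ^ (p - 1) - 1 = ((z ^ (p - 1) - 1 : ℤ_[p]) : ℚ_[p]) := by push_cast; rfl
    have hz : PadicInt.toZMod z ≠ 0 := by
      intro h0
      rw [← RingHom.mem_ker, PadicInt.ker_toZMod, PadicInt.maximalIdeal_eq_span_p,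
        Ideal.mem_span_singleton, ← PadicInt.norm_lt_one_iff_dvd] at h0
      exact h0.ne hn
    rw [e, ← PadicInt.norm_def, PadicInt.norm_lt_one_iff_dvd, ← Ideal.mem_span_singleton,
      ← PadicInt.maximalIdeal_eq_span_p, ← PadicInt.ker_toZMod, RingHom.mem_ker, map_sub, map_pow,
      map_one, ZMod.pow_card_sub_one_eq_one hz, sub_self]
  refine (padic_norm_le_of_lt_one h1).eq_of_not_lt fun hlt => ?_
  have h2 := (h.norm_pow_sub_one_le_iff (p - 1)).1 (padic_norm_le_sq_of_lt hlt)
  have h3 := Nat.le_of_dvd (Nat.sub_pos_of_lt hp.out.one_lt) h2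
  have := hp.out.two_le
  have h4 : 0 < p - 1 := Nat.sub_pos_of_lt hp.out.one_lt
  nlinarith

theorem norm_pow_mul_sub_one (h : GeneratesUnitsModSq p lam) (hp2 : p ≠ 2) (i : ℕ) :
    ‖lam ^ ((p - 1) * i) - 1‖ = ‖(p : ℚ_[p])‖ * ‖(i : ℚ_[p])‖ := by
  have := norm_one_add_pow_sub_one hp.out hp2 padic_prime_ne_zero Padic.norm_p_lt_one
    h.norm_pow_pred_sub_one.le i
  rwa [add_sub_cancel, ← pow_mul, h.norm_pow_pred_sub_one, mul_comm ‖(i : ℚ_[p])‖] at this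

theorem pow_ne_one (h : GeneratesUnitsModSq p lam) (hp2 : p ≠ 2) {n : ℕ} (hn : n ≠ 0) :
    lam ^ n ≠ 1 := by
  intro h1
  obtain ⟨i, rfl⟩ := h.dvd_of_norm_pow_sub_one_lt hp2 (n := n) (by simp [h1])
  have h2 := h.norm_pow_mul_sub_one hp2 i
  rw [h1, sub_self, norm_zero, ← norm_mul, eq_comm, norm_eq_zero, mul_eq_zero] at h2
  rcases h2 with h2 | h2
  · exact padic_prime_ne_zero h2
  · exact hn (by rw [Nat.cast_eq_zero.1 h2, mul_zero])

/-- Successive approximation: the case modulo $p^2$ is the generator hypothesis, and each step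
multiplies by a power of $1+t$ that corrects the next $p$-adic digit. -/
theorem exists_pow_norm_sub_le (h : GeneratesUnitsModSq p lam) (hp2 : p ≠ 2) {v : ℚ_[p]}
    (hv : ‖v‖ = 1) (N : ℕ) : ∃ n : ℕ, ‖lam ^ n - v‖ ≤ ‖(p : ℚ_[p])‖ ^ (N + 2) := by
  have hlam := h.norm_eq_one
  have hlam0 : lam ≠ 0 := norm_pos_iff.1 (hlam ▸ one_pos)
  have hpp := padic_norm_prime_pos (p := p)
  have hp1 : ‖(p : ℚ_[p])‖ < 1 := Padic.norm_p_lt_one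
  induction N with
  | zero =>
    obtain ⟨z, u, rfl, hu, hgen⟩ := h
    have hne : NeZero (p ^ 2) := ⟨pow_ne_zero 2 hp.out.ne_zero⟩
    obtain ⟨y, hy⟩ : ∃ y : ℤ_[p], y = (⟨v, hv.le⟩ : ℤ_[p]) := ⟨_, rfl⟩
    have hyu : IsUnit y := by
      rw [PadicInt.isUnit_iff, hy]
      exact hv
    have hmem : Units.map (PadicInt.toZModPow 2 : ℤ_[p] →+* ZMod (p ^ 2)).toMonoidHom hyu.unit ∈
        Subgroup.zpowers u := hgen ▸ Subgroup.mem_top _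
    rw [← mem_powers_iff_mem_zpowers] at hmem
    obtain ⟨n, hn⟩ := hmem
    refine ⟨n, ?_⟩
    have e : (z : ℚ_[p]) ^ n - v = ((z ^ n - y : ℤ_[p]) : ℚ_[p]) := by rw [hy]; rfl
    rw [e, zero_add, ← toZModPow_two_eq_zero_iff, map_sub, map_pow, hu, sub_eq_zero]
    have := congrArg Units.val hn
    simpa using this
  | succ N ih =>
    obtain ⟨n, hn⟩ := ih
    -- By lifting the exponent, $|t|$ is exactly $|p|^{N+2}$, the size allowed for the present
    -- error. The natural number $j$ below is the residue of the error divided by $\lambda^nt$.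
    obtain ⟨t, ht⟩ : ∃ t, t = lam ^ ((p - 1) * p ^ (N + 1)) - 1 := ⟨_, rfl⟩
    have htn : ‖t‖ = ‖(p : ℚ_[p])‖ ^ (N + 2) := by
      rw [ht, h.norm_pow_mul_sub_one hp2, Nat.cast_pow, norm_pow, ← pow_succ']
    have ht0 : t ≠ 0 := norm_pos_iff.1 (by rw [htn]; positivity)
    have hln : ‖lam ^ n‖ = 1 := by rw [norm_pow, hlam, one_pow]
    obtain ⟨j, hj⟩ := exists_natCast_padic_norm_le (x := (v - lam ^ n) / (lam ^ n * t)) (by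
      rw [norm_div, norm_mul, hln, one_mul, htn, norm_sub_rev]
      exact div_le_one_of_le₀ hn (by positivity))
    have ht1 : ‖t‖ ≤ 1 := by rw [htn]; exact pow_le_one₀ hpp.le hp1.le
    obtain ⟨c, hc, e⟩ := one_add_pow_eq ht1 j
    refine ⟨n + (p - 1) * p ^ (N + 1) * j, ?_⟩
    have e2 : lam ^ (n + (p - 1) * p ^ (N + 1) * j) - v =
        lam ^ n * ((j.choose 2 : ℕ) + c * t) * (t * t)
          - lam ^ n * t * ((v - lam ^ n) / (lam ^ n * t) - j) := by
      have h1 : lam ^ (n + (p - 1) * p ^ (N + 1) * j) = lam ^ n * (1 + t) ^ j := by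
        rw [pow_add, pow_mul lam ((p - 1) * p ^ (N + 1)), ht, add_sub_cancel]
      rw [h1, e]
      field_simp
      ring
    rw [e2]
    apply norm_sub_le_of_le
    · rw [norm_mul, norm_mul, norm_mul, hln, one_mul, htn, ← pow_add]
      have h1 : ‖((j.choose 2 : ℕ) : ℚ_[p]) + c * t‖ ≤ 1 := by
        refine norm_add_le_of_le (norm_natCast_le_one' _) ?_
        rw [norm_mul]
        exact mul_le_one₀ hc (norm_nonneg _) ht1
      calc _ ≤ 1 * ‖(p : ℚ_[p])‖ ^ (N + 2 + (N + 2)) := by gcongr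
        _ ≤ ‖(p : ℚ_[p])‖ ^ (N + 1 + 2) := by
          rw [one_mul]
          exact pow_le_pow_of_le_one hpp.le hp1.le (by omega)
    · rw [norm_mul, norm_mul, hln, one_mul, htn]
      calc _ ≤ ‖(p : ℚ_[p])‖ ^ (N + 2) * ‖(p : ℚ_[p])‖ := by gcongr
        _ = ‖(p : ℚ_[p])‖ ^ (N + 1 + 2) := by ring

theorem hasDensePowers (h : GeneratesUnitsModSq p lam) (hp2 : p ≠ 2) : HasDensePowers lam := by
  intro v hv ε hε
  obtain ⟨N, hN⟩ := exists_pow_lt_of_lt_one hε (Padic.norm_p_lt_one (p := p))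
  obtain ⟨n, hn⟩ := h.exists_pow_norm_sub_le hp2 hv N
  refine ⟨n, hn.trans_lt (lt_of_le_of_lt ?_ hN)⟩
  exact pow_le_pow_of_le_one (norm_nonneg _) Padic.norm_p_lt_one.le (by omega)

end GeneratesUnitsModSq

end PadicGenerator

/-! ### Transport along isomorphisms of topological fields -/

section Transport

variable {K K' : Type*} [NontriviallyNormedField K] [NontriviallyNormedField K']

/-- The condition $|x|<1$ is topological: it says that $x^n\to 0$. -/
theorem norm_map_lt_one {e : K →+* K'} (he : Continuous e) {x : K} (hx : ‖x‖ < 1) :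
    ‖e x‖ < 1 := by
  rw [← tendsto_pow_atTop_nhds_zero_iff_norm_lt_one] at hx ⊢
  have := (he.tendsto 0).comp hx
  simpa [Function.comp_def] using this

theorem norm_map_eq_one {e : K →+* K'}
    (hinv : ∀ x, ‖e x‖ < 1 → ‖x‖ < 1) {x : K} (hx : ‖x‖ = 1) : ‖e x‖ = 1 := by
  apply le_antisymm
  · by_contra! hgt
    have h1 : ‖e x⁻¹‖ < 1 := by
      rw [map_inv₀, norm_inv]
      exact inv_lt_one_of_one_lt₀ hgt
    have := hinv _ h1
    rw [norm_inv, hx, inv_one] at this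
    exact lt_irrefl _ this
  · by_contra! hlt
    exact (hinv x hlt).ne hx

theorem norm_ringEquiv_eq_one_iff (e : K ≃+* K') (he : Continuous e)
    (he' : Continuous e.symm) {x : K} : ‖e x‖ = 1 ↔ ‖x‖ = 1 := by
  have h1 : ∀ x, ‖e x‖ < 1 → ‖x‖ < 1 := fun x hx => by
    simpa using norm_map_lt_one (e := (e.symm : K' →+* K)) he' hx
  have h2 : ∀ y, ‖e.symm y‖ < 1 → ‖y‖ < 1 := fun y hy => by
    simpa using norm_map_lt_one (e := (e : K →+* K')) he hy
  constructor
  · intro hx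
    simpa using norm_map_eq_one (e := (e.symm : K' →+* K)) h2 hx
  · exact norm_map_eq_one (e := (e : K →+* K')) h1

theorem HasDensePowers.of_ringEquiv (e : K ≃+* K') (he : Continuous e)
    (he' : Continuous e.symm) {lam : K} (h : HasDensePowers (e lam)) :
    HasDensePowers lam := by
  intro u hu ε hε
  obtain ⟨δ, hδ, hball⟩ := Metric.continuous_iff.1 he' (e u) ε hε
  obtain ⟨n, hn⟩ := h (e u) ((norm_ringEquiv_eq_one_iff e he he').2 hu) δ hδ
  refine ⟨n, ?_⟩
  have := hball (e lam ^ n) (by rwa [dist_eq_norm])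
  rwa [map_pow, e.symm_apply_apply, e.symm_apply_apply, dist_eq_norm] at this

theorem compactSpace_unitSphere_of_ringEquiv [ProperSpace K'] (e : K ≃+* K') (he : Continuous e)
    (he' : Continuous e.symm) :
    CompactSpace (Metric.sphere (0 : K) 1) := by
  rw [← isCompact_iff_compactSpace]
  have e1 : Metric.sphere (0 : K) 1 = e.symm '' Metric.sphere (0 : K') 1 := by
    ext x
    simp only [mem_sphere_zero_iff_norm, Set.mem_image]
    constructor
    · intro hx
      exact ⟨e x, (norm_ringEquiv_eq_one_iff e he he').2 hx, e.symm_apply_apply x⟩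
    · rintro ⟨y, hy, rfl⟩
      rw [← norm_ringEquiv_eq_one_iff e he he', e.apply_symm_apply]
      exact hy
  rw [e1]
  exact (isCompact_sphere _ _).image he'

theorem IsPadicWithGenerator.hasDensePowers {lam : K} (h : IsPadicWithGenerator lam) :
    HasDensePowers lam ∧ CompactSpace (Metric.sphere (0 : K) 1) := by
  obtain ⟨p, hp, hp2, e, he, he', hgen⟩ := h
  exact ⟨HasDensePowers.of_ringEquiv e he he' (hgen.hasDensePowers hp2),
    compactSpace_unitSphere_of_ringEquiv e he he'⟩

end Transport

/-! ### Ergodicity on linearization spheres -/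

section Ergodicity

variable {K : Type*} [NontriviallyNormedField K] [IsUltrametricDist K] [CompleteSpace K]
  [MeasurableSpace K] [BorelSpace K] {L : Type*} [NontriviallyNormedField L] [IsUltrametricDist L]
  [CompleteSpace L] [IsAlgClosed L] [NormedAlgebra K L]

theorem tfae_isErgodic {f : K → K} {x₀ : K} {F : PowerSeries K} {U : Set K} {Δ : Set L}
    (hf : HolomorphicWithFixedPoint f x₀ F U) (hΔ : IsLinearizationDisc F x₀ Δ)
    (hΔU : restrictDisc K Δ ⊆ U) {r : ℝ} (hr : 0 < r) (hne : (Metric.sphere x₀ r).Nonempty)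
    (hsub : Metric.sphere x₀ r ⊆ restrictDisc K Δ) :
    ∃ hS : Set.MapsTo f (Metric.sphere x₀ r) (Metric.sphere x₀ r),
      List.TFAE
        [IsErgodicForSome (hS.restrict f (Metric.sphere x₀ r) (Metric.sphere x₀ r)),
         IsErgodicForAll (hS.restrict f (Metric.sphere x₀ r) (Metric.sphere x₀ r)),
         IsPadicWithGenerator (PowerSeries.coeff 1 F)] := by
  obtain ⟨hS, Φ, lam, hlam, hΦ⟩ := exists_homeomorph_unitSphere hf hΔ hΔU hr hne hsub
  refine ⟨hS, ?_⟩
  tfae_have 1 → 3 := fun h => by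
    obtain ⟨μ, hμ, he⟩ := h.conj (T' := (lam * ·)) Φ hΦ
    rw [← hlam]
    exact (hasDensePowers_of_ergodic hμ he).isPadicWithGenerator (by simp)
  tfae_have 3 → 2 := fun h => by
    obtain ⟨hd, hc⟩ := h.hasDensePowers
    rw [← hlam] at hd
    refine (isErgodicForAll_of_hasDensePowers hd).conj Φ.symm fun x => ?_
    rw [Φ.symm_apply_eq, hΦ, Φ.apply_symm_apply]
  tfae_have 2 → 1 := fun ⟨⟨μ, hμ⟩, hall⟩ => ⟨μ, hμ, hall μ hμ⟩
  tfae_finish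

end Ergodicity

/-! ### The formal conjugacy -/

section Formal

open PowerSeries

/-- The power $F^l$ is divisible by $X^l$, so only the indices $l\le k$ contribute. -/
theorem coeff_subst_eq_sum {R : Type*} [CommRing R] {F : PowerSeries R} (hF : coeff 0 F = 0)
    (G : PowerSeries R) (k : ℕ) :
    coeff k (subst F G) = ∑ l ∈ Finset.range (k + 1), coeff l G * coeff k (F ^ l) := by
  have hs : HasSubst F := HasSubst.of_constantCoeff_zero' (by simpa using hF)
  have hX : X ∣ F := X_dvd_iff.2 (by simpa using hF)
  rw [coeff_subst' hs, finsum_eq_sum_of_support_subset]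
  · rfl
  · intro l hl
    rw [Finset.coe_range, Set.mem_Iio, Nat.lt_succ_iff]
    by_contra! hlt
    refine hl ?_
    dsimp only
    rw [X_pow_dvd_iff.1 (pow_dvd_pow_of_dvd hX l) k hlt, smul_zero]

variable {K : Type*} [NontriviallyNormedField K]

/-- The coefficients of the formal conjugacy function. -/
def conjugacyCoeff (F : PowerSeries K) : ℕ → K
  | 0 => 0
  | 1 => 1
  | k + 2 => (∑ l : Fin (k + 2), conjugacyCoeff F l * coeff (k + 2) (F ^ (l : ℕ))) /
      (coeff 1 F - coeff 1 F ^ (k + 2))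
  decreasing_by exact l.2

theorem coeff_X_mul_pow (F₁ : PowerSeries K) (l n : ℕ) :
    coeff (l + n) ((X * F₁) ^ l) = coeff n (F₁ ^ l) := by
  rw [mul_pow, add_comm, coeff_X_pow_mul]

theorem coeff_self_pow {F : PowerSeries K} (hF : coeff 0 F = 0) (l : ℕ) :
    coeff l (F ^ l) = coeff 1 F ^ l := by
  obtain ⟨F₁, rfl⟩ : X ∣ F := X_dvd_iff.2 (by simpa using hF)
  have h1 := coeff_X_mul_pow F₁ l 0
  have h2 := coeff_X_mul_pow F₁ 1 0
  simp only [add_zero, pow_one] at h1 h2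
  rw [h1, h2]
  simp

theorem coeff_pow_eq_zero {F : PowerSeries K} (hF : coeff 0 F = 0) {k l : ℕ} (h : k < l) :
    coeff k (F ^ l) = 0 :=
  X_pow_dvd_iff.1 (pow_dvd_pow_of_dvd (X_dvd_iff.2 (by simpa using hF)) l) k h

theorem exists_isFormalConjugacy {F : PowerSeries K} (hF : coeff 0 F = 0) (h0 : coeff 1 F ≠ 0)
    (hne : ∀ n : ℕ, 1 ≤ n → coeff 1 F ^ n ≠ 1) : ∃ G, IsFormalConjugacy F G := by
  refine ⟨mk (conjugacyCoeff F), by simp [conjugacyCoeff], by simp [conjugacyCoeff], ?_⟩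
  ext k
  rw [coeff_subst_eq_sum hF, Finset.sum_range_succ, coeff_C_mul, coeff_mk, coeff_self_pow hF]
  match k with
  | 0 => simp [conjugacyCoeff]
  | 1 => simp [conjugacyCoeff]
  | k + 2 =>
    have hd : coeff 1 F - coeff 1 F ^ (k + 2) ≠ 0 := by
      rw [pow_succ', ← mul_one_sub]
      exact mul_ne_zero h0 (sub_ne_zero.2 (hne (k + 1) (by omega)).symm)
    have hrec : conjugacyCoeff F (k + 2) * (coeff 1 F - coeff 1 F ^ (k + 2)) =
        ∑ l ∈ Finset.range (k + 2), conjugacyCoeff F l * coeff (k + 2) (F ^ l) := by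
      rw [conjugacyCoeff, div_mul_cancel₀ _ hd,
        Finset.sum_range fun l => conjugacyCoeff F l * coeff (k + 2) (F ^ l)]
    simp only [coeff_mk]
    rw [← hrec]
    ring

theorem IsFormalConjugacy.coeff_mul_sub {F G : PowerSeries K} (hG : IsFormalConjugacy F G)
    (hF : coeff 0 F = 0) (k : ℕ) :
    coeff k G * (coeff 1 F - coeff 1 F ^ k) =
      ∑ l ∈ Finset.range k, coeff l G * coeff k (F ^ l) := by
  have h := congrArg (coeff k) hG.schroeder
  rw [coeff_subst_eq_sum hF, Finset.sum_range_succ, coeff_C_mul, coeff_self_pow hF] at h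
  linear_combination -h

variable [IsUltrametricDist K] {F G : PowerSeries K} {a : ℝ}

theorem norm_coeff_mul_le (ha : 0 ≤ a) {A B : PowerSeries K} (hA : ∀ n, ‖coeff n A‖ ≤ a ^ n)
    (hB : ∀ n, ‖coeff n B‖ ≤ a ^ n) (n : ℕ) : ‖coeff n (A * B)‖ ≤ a ^ n := by
  rw [coeff_mul]
  refine norm_sum_le_of_forall_le (by positivity) fun ij hij => ?_
  rw [norm_mul, ← Finset.HasAntidiagonal.mem_antidiagonal.1 hij, pow_add]
  exact mul_le_mul (hA _) (hB _) (norm_nonneg _) (by positivity)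

theorem norm_coeff_pow_le (ha : 0 ≤ a) (hF0 : coeff 0 F = 0)
    (hF : ∀ n, ‖coeff (n + 1) F‖ ≤ a ^ n) (l n : ℕ) : ‖coeff (l + n) (F ^ l)‖ ≤ a ^ n := by
  obtain ⟨F₁, rfl⟩ : X ∣ F := X_dvd_iff.2 (by simpa using hF0)
  rw [coeff_X_mul_pow]
  have h1 : ∀ n, ‖coeff n F₁‖ ≤ a ^ n := fun n => by
    have := hF n
    rwa [coeff_succ_X_mul] at this
  induction l generalizing n with
  | zero =>
    rw [pow_zero, coeff_one]
    split_ifs with h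
    · simp [h]
    · rw [norm_zero]; positivity
  | succ l ih =>
    rw [pow_succ]
    exact norm_coeff_mul_le ha ih h1 n

/-- The estimate of the coefficients of the conjugacy function by the small divisors. -/
theorem IsFormalConjugacy.norm_coeff_mul_prod_le (hG : IsFormalConjugacy F G) (ha : 0 ≤ a)
    (hF0 : coeff 0 F = 0) (hF1 : ‖coeff 1 F‖ = 1) (hF : ∀ n, ‖coeff (n + 1) F‖ ≤ a ^ n) (n : ℕ) :
    ‖coeff (n + 1) G‖ * ∏ j ∈ Finset.range n, ‖coeff 1 F ^ (j + 1) - 1‖ ≤ a ^ n := by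
  have hfac : ∀ j, ‖coeff 1 F ^ (j + 1) - 1‖ ≤ 1 := fun j =>
    norm_sub_le_of_le (by rw [norm_pow, hF1, one_pow]) (by simp)
  have hpos : ∀ n, 0 ≤ ∏ j ∈ Finset.range n, ‖coeff 1 F ^ (j + 1) - 1‖ := fun n =>
    Finset.prod_nonneg fun _ _ => norm_nonneg _
  -- All factors are at most 1, so a longer product may be replaced by a shorter one in upper
  -- bounds.
  have hanti : Antitone fun n => ∏ j ∈ Finset.range n, ‖coeff 1 F ^ (j + 1) - 1‖ := by
    refine antitone_nat_of_succ_le fun n => ?_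
    rw [Finset.prod_range_succ]
    exact mul_le_of_le_one_right (hpos n) (hfac n)
  induction n using Nat.strong_induction_on with
  | _ n ih =>
    cases n with
    | zero => simp [hG.coeff_one]
    | succ n =>
      have h1 : ‖coeff (n + 1 + 1) G‖ * ‖coeff 1 F ^ (n + 1) - 1‖ =
          ‖∑ l ∈ Finset.range (n + 1 + 1), coeff l G * coeff (n + 1 + 1) (F ^ l)‖ := by
        rw [← hG.coeff_mul_sub hF0, norm_mul, pow_succ' _ (n + 1), ← mul_one_sub, norm_mul, hF1,
          one_mul, norm_sub_rev]
      rw [Finset.prod_range_succ, mul_comm (∏ j ∈ Finset.range n, _), ← mul_assoc, h1]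
      set E := ∏ j ∈ Finset.range n, ‖coeff 1 F ^ (j + 1) - 1‖ with hE
      -- Non-resonance is not assumed here, so the product of small divisors may vanish; the
      -- estimate is then trivial.
      have h2 : ‖(∑ l ∈ Finset.range (n + 1 + 1), coeff l G * coeff (n + 1 + 1) (F ^ l))‖ ≤
          a ^ (n + 1) / E ∨ E = 0 := by
        rcases (hpos n).eq_or_lt with h0 | h0
        · exact Or.inr h0.symm
        refine Or.inl (norm_sum_le_of_forall_le (by positivity) fun l hl => ?_)
        rw [Finset.mem_range] at hl
        cases l with
        | zero =>
          rw [hG.coeff_zero, zero_mul, norm_zero]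
          positivity
        | succ l =>
          obtain ⟨m, hm⟩ := Nat.exists_eq_add_of_le (show l ≤ n by omega)
          rw [le_div_iff₀ h0, norm_mul]
          have h3 := norm_coeff_pow_le ha hF0 hF (l + 1) (m + 1)
          rw [show l + 1 + (m + 1) = n + 1 + 1 by omega] at h3
          calc ‖coeff (l + 1) G‖ * ‖coeff (n + 1 + 1) (F ^ (l + 1))‖ * E
              ≤ ‖coeff (l + 1) G‖ * a ^ (m + 1) *
                  ∏ j ∈ Finset.range l, ‖coeff 1 F ^ (j + 1) - 1‖ := by
                gcongr
                exact hanti (show l ≤ n by omega)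
            _ = ‖coeff (l + 1) G‖ * (∏ j ∈ Finset.range l, ‖coeff 1 F ^ (j + 1) - 1‖) *
                  a ^ (m + 1) := by ring
            _ ≤ a ^ l * a ^ (m + 1) := by gcongr; exact ih l (by omega)
            _ = a ^ (n + 1) := by rw [← pow_add, hm, add_assoc]
      rcases h2 with h2 | h2
      · rcases (hpos n).eq_or_lt with h0 | h0
        · rw [hE, ← h0, mul_zero]; positivity
        · exact (le_div_iff₀ h0).1 h2
      · rw [h2, mul_zero]; positivity

end Formal

/-! ### Convergence of the conjugacy -/

section Convergence

open Filter Topology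

variable {K : Type*} [NontriviallyNormedField K] {L : Type*} [NontriviallyNormedField L]
  [NormedAlgebra K L]

theorem term_mul (A B : PowerSeries K) (y : L) (n : ℕ) :
    term (A * B) y n =
      ∑ ij ∈ Finset.HasAntidiagonal.antidiagonal n, term A y ij.1 * term B y ij.2 := by
  rw [term, PowerSeries.coeff_mul, map_sum, Finset.sum_mul]
  refine Finset.sum_congr rfl fun ij hij => ?_
  rw [term, term, ← Finset.HasAntidiagonal.mem_antidiagonal.1 hij, map_mul]
  ring

variable [IsUltrametricDist L]

theorem ConvergesAt.mul {A B : PowerSeries K} {y : L} (hA : ConvergesAt A y)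
    (hB : ConvergesAt B y) :
    ConvergesAt (A * B) y ∧ value (A * B) y = value A y * value B y := by
  have : NonarchimedeanRing L :=
    { is_nonarchimedean := NonarchimedeanAddGroup.is_nonarchimedean }
  have hAB : Summable fun ij : ℕ × ℕ => term A y ij.1 * term B y ij.2 :=
    Summable.mul_of_nonarchimedean hA hB
  have h1 := summable_sum_mul_antidiagonal_of_summable_mul hAB
  have h2 := hA.tsum_mul_tsum_eq_tsum_sum_antidiagonal hB hAB
  simp only [← term_mul] at h1 h2
  exact ⟨h1, h2.symm⟩

theorem ConvergesAt.pow {A : PowerSeries K} {y : L} (hA : ConvergesAt A y) (l : ℕ) :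
    ConvergesAt (A ^ l) y ∧ value (A ^ l) y = value A y ^ l := by
  induction l with
  | zero =>
    have : HasSum (term (1 : PowerSeries K) y) 1 := by
      have e : ∀ n, n ≠ 0 → term (1 : PowerSeries K) y n = 0 := fun n hn => by
        simp [term, PowerSeries.coeff_one, hn]
      have := hasSum_single (f := term (1 : PowerSeries K) y) 0 e
      simpa [term] using this
    rw [pow_zero, pow_zero]
    exact ⟨this.summable, this.tsum_eq⟩
  | succ l ih =>
    rw [pow_succ, pow_succ, ← ih.2]
    exact ih.1.mul hA

variable {F G : PowerSeries K} {a r θ : ℝ}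

theorem norm_value_le (hθ0 : 0 ≤ θ) (hθ1 : θ < 1) (hF0 : PowerSeries.coeff 0 F = 0)
    (hF : ∀ n, ‖PowerSeries.coeff (n + 1) F‖ * r ^ n ≤ θ ^ n) {y : L} (hy : ‖y‖ ≤ r) :
    ‖value F y‖ ≤ r := by
  have hr : 0 ≤ r := (norm_nonneg _).trans hy
  refine IsUltrametricDist.norm_tsum_le_of_forall_le_of_nonneg hr fun n => ?_
  rw [norm_term]
  cases n with
  | zero => simpa [hF0] using hr
  | succ n =>
    rw [pow_succ, ← mul_assoc]
    calc _ ≤ ‖PowerSeries.coeff (n + 1) F‖ * r ^ n * r := by gcongr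
      _ ≤ θ ^ n * r := by gcongr; exact hF n
      _ ≤ 1 * r := by gcongr; exact pow_le_one₀ hθ0 hθ1.le
      _ = r := one_mul r

variable [CompleteSpace L]

theorem convergesAt_of_norm_le (hr : 0 ≤ r) (hθ0 : 0 ≤ θ) (hθ1 : θ < 1)
    (hF : ∀ n, ‖PowerSeries.coeff (n + 1) F‖ * r ^ n ≤ θ ^ n) {y : L} (hy : ‖y‖ ≤ r) :
    ConvergesAt F y := by
  refine (summable_nat_add_iff 1).1 (summable_of_tendsto_zero ?_)
  refine squeeze_zero_norm (a := fun n => θ ^ n * r) (fun n => ?_) ?_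
  · rw [norm_term, pow_succ, ← mul_assoc]
    calc _ ≤ ‖PowerSeries.coeff (n + 1) F‖ * r ^ n * r := by gcongr
      _ ≤ θ ^ n * r := by gcongr; exact hF n
  · simpa using (tendsto_pow_atTop_nhds_zero_of_lt_one hθ0 hθ1).mul_const r

variable [IsUltrametricDist K]

/-- The Schröder equation for values is the formal one after interchanging a double sum. In the
ultrametric setting it suffices that the terms tend to 0 on $\mathbb{N}^2$: they vanish for $k<l$
and decay like $\theta^k$ uniformly in $l$. -/
theorem IsFormalConjugacy.value_value (hG : IsFormalConjugacy F G) (ha : 0 ≤ a) (hθ0 : 0 ≤ θ)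
    (hθ1 : θ < 1) (har : a * r ≤ θ) (hF0 : PowerSeries.coeff 0 F = 0)
    (hF : ∀ n, ‖PowerSeries.coeff (n + 1) F‖ ≤ a ^ n)
    (hGr : ∀ n, ‖PowerSeries.coeff (n + 1) G‖ * r ^ n ≤ θ ^ n) {y : L} (hy : ‖y‖ ≤ r)
    (hFy : ConvergesAt F y) :
    value G (value F y) = algebraMap K L (PowerSeries.coeff 1 F) * value G y := by
  have hr : 0 ≤ r := (norm_nonneg _).trans hy
  let u : ℕ → ℕ → L := fun l k =>
    algebraMap K L (PowerSeries.coeff l G * PowerSeries.coeff k (F ^ l)) * y ^ k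
  have hzero : ∀ l k, k < l → u l k = 0 := fun l k h => by
    simp only [u]
    rw [coeff_pow_eq_zero hF0 h, mul_zero, map_zero, zero_mul]
  have hbound : ∀ l k, ‖u l (k + 1)‖ ≤ θ ^ k * r := fun l k => by
    rcases lt_or_ge (k + 1) l with h | h
    · rw [hzero l _ h, norm_zero]; positivity
    cases l with
    | zero =>
      simp only [u, hG.coeff_zero, zero_mul, map_zero, norm_zero]
      positivity
    | succ l =>
      obtain ⟨m, rfl⟩ := Nat.exists_eq_add_of_le (Nat.le_of_succ_le_succ h)
      have h1 := norm_coeff_pow_le ha hF0 hF (l + 1) m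
      rw [show l + 1 + m = l + m + 1 by ring] at h1
      simp only [u]
      rw [norm_mul, norm_algebraMap', norm_mul, norm_pow]
      calc _ ≤ ‖PowerSeries.coeff (l + 1) G‖ * a ^ m * r ^ (l + m + 1) := by gcongr
        _ = ‖PowerSeries.coeff (l + 1) G‖ * r ^ l * (a * r) ^ m * r := by ring
        _ ≤ θ ^ l * θ ^ m * r := by gcongr; exact hGr l
        _ = θ ^ (l + m) * r := by rw [pow_add]
  have hsum : Summable (Function.uncurry u) := by
    apply NonarchimedeanAddGroup.summable_of_tendsto_cofinite_zero
    rw [Metric.tendsto_nhds]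
    intro ε hε
    have ht : Tendsto (fun n => θ ^ n * r) atTop (𝓝 0) := by
      simpa using (tendsto_pow_atTop_nhds_zero_of_lt_one hθ0 hθ1).mul_const r
    obtain ⟨N, hN⟩ := eventually_atTop.1 (ht.eventually_lt_const hε)
    refine ((Finset.range (N + 1) ×ˢ Finset.range (N + 1)).finite_toSet).subset ?_
    rintro ⟨l, k⟩ hlk
    have hlk : ¬ dist (u l k) 0 < ε := hlk
    rw [dist_zero_right] at hlk
    have hk : k < N + 1 := by
      by_contra! hge
      obtain ⟨k, rfl⟩ := Nat.exists_eq_add_of_le' (show 1 ≤ k by omega)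
      exact hlk ((hbound l k).trans_lt (hN k (by omega)))
    have hl : l ≤ k := by
      by_contra! hlt
      rw [hzero l k hlt, norm_zero] at hlk
      exact hlk hε
    simp only [Finset.coe_product, Set.mem_prod, Finset.coe_range, Set.mem_Iio]
    omega
  have hrow : ∀ l, term G (value F y) l = ∑' k, u l k := fun l => by
    rw [term, ← (hFy.pow l).2, value, ← tsum_mul_left]
    refine tsum_congr fun k => ?_
    simp only [u, term, map_mul]
    ring
  have hcol : ∀ k, ∑' l, u l k = algebraMap K L (PowerSeries.coeff 1 F) * term G y k := fun k => by
    rw [tsum_eq_sum (s := Finset.range (k + 1)) fun l hl => hzero l k (by simpa using hl)]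
    simp only [u]
    rw [← Finset.sum_mul, ← map_sum, ← coeff_subst_eq_sum hF0, hG.schroeder,
      PowerSeries.coeff_C_mul, map_mul, term, mul_assoc]
  calc value G (value F y) = ∑' l, ∑' k, u l k := tsum_congr hrow
    _ = ∑' k, ∑' l, u l k := hsum.tsum_comm.symm
    _ = ∑' k, algebraMap K L (PowerSeries.coeff 1 F) * term G y k := tsum_congr hcol
    _ = _ := by rw [tsum_mul_left, value]

theorem IsFormalConjugacy.linearizesOn (hG : IsFormalConjugacy F G) (ha : 0 ≤ a) (hr : 0 ≤ r)
    (hθ0 : 0 ≤ θ) (hθ1 : θ < 1) (har : a * r ≤ θ) (hF0 : PowerSeries.coeff 0 F = 0)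
    (hF : ∀ n, ‖PowerSeries.coeff (n + 1) F‖ ≤ a ^ n)
    (hGr : ∀ n, ‖PowerSeries.coeff (n + 1) G‖ * r ^ n ≤ θ ^ n) (x₀ : L) :
    LinearizesOn F G x₀ (Metric.closedBall x₀ r) := by
  have hFr : ∀ n, ‖PowerSeries.coeff (n + 1) F‖ * r ^ n ≤ θ ^ n := fun n => by
    calc _ ≤ a ^ n * r ^ n := by gcongr; exact hF n
      _ = (a * r) ^ n := by rw [mul_pow]
      _ ≤ θ ^ n := by gcongr
  have hball : ∀ x ∈ Metric.closedBall x₀ r, ‖x - x₀‖ ≤ r := fun x hx => by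
    rwa [← dist_eq_norm]
  have hcF : ∀ y : L, ‖y‖ ≤ r → ConvergesAt F y := fun y => convergesAt_of_norm_le hr hθ0 hθ1 hFr
  have hcG : ∀ y : L, ‖y‖ ≤ r → ConvergesAt G y := fun y => convergesAt_of_norm_le hr hθ0 hθ1 hGr
  refine ⟨fun x hx => hcF _ (hball x hx), fun x hx => hcG _ (hball x hx),
    fun x hx => hcG _ (norm_value_le hθ0 hθ1 hF0 hFr (hball x hx)),
    fun x hx => hG.value_value ha hθ0 hθ1 har hF0 hF hGr (hball x hx) (hcF _ (hball x hx)), ?_⟩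
  intro x hx z hz hxz
  by_contra hne
  have hpos : 0 < ‖x - z‖ := norm_pos_iff.2 (sub_ne_zero.2 hne)
  have hG2 : ∀ n, ‖PowerSeries.coeff (n + 2) G‖ * r ^ (n + 1) ≤ θ := fun n =>
    (hGr (n + 1)).trans (pow_le_of_le_one hθ0 hθ1.le n.succ_ne_zero)
  have h1 := norm_value_sub_le hθ0 hG2 (hball x hx) (hball z hz) (hcG _ (hball x hx))
    (hcG _ (hball z hz))
  have hxz : value G (x - x₀) = value G (z - x₀) := hxz
  rw [hxz, hG.coeff_one, map_one, one_mul, sub_self, zero_sub, norm_neg,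
    sub_sub_sub_cancel_right] at h1
  nlinarith

end Convergence

/-! ### The largest disc -/

section Greatest

/-- The radius is the supremum of the distances from $x_0$; the disc is closed or open according to
whether the supremum is attained. -/
theorem isDiscAbout_of_forall_closedBall_subset {X : Type*} [PseudoMetricSpace X] {x₀ : X}
    {V : Set X} {r₀ : ℝ} (hr₀ : 0 < r₀) (hball : Metric.ball x₀ r₀ ⊆ V)
    (hV : ∀ x ∈ V, Metric.closedBall x₀ (dist x x₀) ⊆ V) : IsDiscAbout x₀ V := by
  by_cases huniv : V = Set.univ
  · exact Or.inl huniv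
  obtain ⟨y, hy⟩ := (Set.ne_univ_iff_exists_notMem V).1 huniv
  have hx₀ : x₀ ∈ V := hball (Metric.mem_ball_self hr₀)
  let D : Set ℝ := (fun x => dist x x₀) '' V
  have hbdd : BddAbove D := by
    refine ⟨dist y x₀, ?_⟩
    rintro _ ⟨x, hx, rfl⟩
    by_contra! hlt
    exact hy (hV x hx (Metric.mem_closedBall.2 hlt.le))
  have hle : ∀ x ∈ V, dist x x₀ ≤ sSup D := fun x hx => le_csSup hbdd ⟨x, hx, rfl⟩
  by_cases hatt : ∃ x ∈ V, dist x x₀ = sSup D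
  · obtain ⟨x, hx, hxD⟩ := hatt
    rcases (dist_nonneg (x := x) (y := x₀)).eq_or_lt with h0 | h0
    -- If the supremum is 0, the radius must still be positive; `r₀` serves, since then all of `V`
    -- lies at distance 0.
    · refine Or.inr ⟨r₀, hr₀, Or.inl (Set.Subset.antisymm (fun z hz => ?_) hball)⟩
      rw [Metric.mem_ball]
      exact (hle z hz).trans_lt (by rwa [← hxD, ← h0])
    · refine Or.inr ⟨dist x x₀, h0, Or.inr (Set.Subset.antisymm (fun z hz => ?_) (hV x hx))⟩
      rw [hxD]
      exact hle z hz
  · push Not at hatt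
    have hlt : ∀ x ∈ V, dist x x₀ < sSup D := fun x hx => lt_of_le_of_ne (hle x hx) (hatt x hx)
    refine Or.inr ⟨sSup D, by simpa using hlt x₀ hx₀, Or.inl (Set.Subset.antisymm hlt ?_)⟩
    intro z hz
    obtain ⟨_, ⟨x, hx, rfl⟩, hzx⟩ := exists_lt_of_lt_csSup (Set.Nonempty.image _ ⟨x₀, hx₀⟩)
      (Metric.mem_ball.1 hz)
    exact hV x hx (Metric.mem_closedBall.2 hzx.le)

theorem IsDiscAbout.exists_ball_subset {X : Type*} [PseudoMetricSpace X] {x₀ : X} {U : Set X}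
    (hU : IsDiscAbout x₀ U) : ∃ r, 0 < r ∧ Metric.ball x₀ r ⊆ U := by
  rcases hU with rfl | ⟨R, hR, rfl | rfl⟩
  · exact ⟨1, one_pos, Set.subset_univ _⟩
  · exact ⟨R, hR, le_rfl⟩
  · exact ⟨R, hR, Metric.ball_subset_closedBall⟩

/-- The union of all admissible discs is admissible: discs about a common centre are nested, so any
two of its points lie in one admissible disc, where $g$ is one-to-one. -/
theorem exists_isGreatest_linearizesOn {K : Type*} [NontriviallyNormedField K] {L : Type*}
    [NontriviallyNormedField L] [NormedAlgebra K L] {F G : PowerSeries K} {x₀ : L} {U₀ : Set L}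
    (hU₀ : IsDiscAbout x₀ U₀) (hlin : LinearizesOn F G x₀ U₀) :
    ∃ Δ, IsGreatest {U : Set L | IsDiscAbout x₀ U ∧ LinearizesOn F G x₀ U} Δ := by
  let 𝒰 : Set (Set L) := {U | IsDiscAbout x₀ U ∧ LinearizesOn F G x₀ U}
  refine ⟨⋃₀ 𝒰, ⟨?_, ?_⟩, fun U hU => Set.subset_sUnion_of_mem hU⟩
  · obtain ⟨r, hr, hsub⟩ := hU₀.exists_ball_subset
    refine isDiscAbout_of_forall_closedBall_subset hr
      (hsub.trans (Set.subset_sUnion_of_mem (t := U₀) ⟨hU₀, hlin⟩)) ?_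
    rintro x ⟨U, hU, hx⟩
    exact (hU.1.closedBall_subset hx).trans (Set.subset_sUnion_of_mem hU)
  · refine ⟨?_, ?_, ?_, ?_, ?_⟩
    · rintro x ⟨U, hU, hx⟩
      exact hU.2.conv_f x hx
    · rintro x ⟨U, hU, hx⟩
      exact hU.2.conv_g x hx
    · rintro x ⟨U, hU, hx⟩
      exact hU.2.conv_comp x hx
    · rintro x ⟨U, hU, hx⟩
      exact hU.2.schroeder x hx
    · rintro x ⟨U, hU, hx⟩ y ⟨V, hV, hy⟩ hxy
      rcases le_total (dist x x₀) (dist y x₀) with h | h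
      · exact hV.2.injOn (hV.1.closedBall_subset hy (Metric.mem_closedBall.2 h)) hy hxy
      · exact hU.2.injOn hx (hU.1.closedBall_subset hx (Metric.mem_closedBall.2 h)) hxy

end Greatest

/-! ### The growth of the coefficients -/

section Growth

variable {K : Type*} [NontriviallyNormedField K] {F : PowerSeries K}

theorem growth_nonneg (F : PowerSeries K) : 0 ≤ growth F := by
  refine Real.sSup_nonneg ?_
  rintro t ⟨i, -, rfl⟩
  positivity

theorem growthSet_eq (F : PowerSeries K) : growthSet F =
    Set.range fun n : ℕ => ‖PowerSeries.coeff (n + 2) F‖ ^ (((n + 1 : ℕ) : ℝ)⁻¹) := by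
  have e : ∀ n : ℕ, 1 / (((n + 2 : ℕ) : ℝ) - 1) = ((n + 1 : ℕ) : ℝ)⁻¹ := fun n => by
    push_cast
    rw [one_div]
    congr 1
    ring
  ext t
  constructor
  · rintro ⟨i, hi, rfl⟩
    obtain ⟨n, rfl⟩ := Nat.exists_eq_add_of_le' hi
    exact ⟨n, by rw [e]⟩
  · rintro ⟨n, rfl⟩
    exact ⟨n + 2, by omega, by rw [e]⟩

theorem norm_coeff_le_growth_pow (hb : BddAbove (growthSet F))
    (h1 : ‖PowerSeries.coeff 1 F‖ = 1) (n : ℕ) :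
    ‖PowerSeries.coeff (n + 1) F‖ ≤ growth F ^ n := by
  cases n with
  | zero => simp [h1]
  | succ n =>
    rw [← Real.rpow_inv_natCast_pow (norm_nonneg (PowerSeries.coeff (n + 1 + 1) F)) n.succ_ne_zero]
    gcongr
    refine le_csSup hb ?_
    rw [growthSet_eq]
    exact ⟨n, rfl⟩

theorem exists_one_lt_norm_coeff_mul_pow {r : ℝ} (hr : 0 < r) (h : 1 < growth F * r) :
    ∃ n, 1 < ‖PowerSeries.coeff (n + 2) F‖ * r ^ (n + 1) := by
  rw [← div_lt_iff₀ hr, growth, growthSet_eq] at h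
  obtain ⟨_, ⟨n, rfl⟩, hn⟩ := exists_lt_of_lt_csSup (Set.range_nonempty _) h
  refine ⟨n, ?_⟩
  rw [div_lt_iff₀ hr] at hn
  have := one_lt_pow₀ hn n.succ_ne_zero
  rwa [mul_pow, Real.rpow_inv_natCast_pow (norm_nonneg _) n.succ_ne_zero] at this

end Growth

/-! ### The linearization disc over the `p`-adic numbers -/

section PadicRadius

open Nat

variable {p : ℕ} [hp : Fact p.Prime] {lam : ℚ_[p]}

theorem padic_norm_factorial (N : ℕ) :
    ‖((N ! : ℕ) : ℚ_[p])‖ = ‖(p : ℚ_[p])‖ ^ padicValNat p (N !) := by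
  rw [Padic.norm_eq_zpow_neg_valuation (by exact_mod_cast N.factorial_ne_zero),
    Padic.valuation_natCast, Padic.norm_p, inv_pow, zpow_neg, zpow_natCast]

namespace GeneratesUnitsModSq

/-- Only exponents divisible by $p-1$ contribute, and the exponent $(p-1)i$ contributes $|p||i|$. -/
theorem prod_norm_pow_sub_one (h : GeneratesUnitsModSq p lam) (hp2 : p ≠ 2) (n : ℕ) :
    ∏ j ∈ Finset.range n, ‖lam ^ (j + 1) - 1‖ =
      ‖(p : ℚ_[p])‖ ^ (n / (p - 1)) * ‖(((n / (p - 1)) ! : ℕ) : ℚ_[p])‖ := by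
  induction n with
  | zero => simp
  | succ n ih =>
    rw [Finset.prod_range_succ, ih, Nat.succ_div]
    split_ifs with hd
    · have e : n + 1 = (p - 1) * (n / (p - 1) + 1) := by
        have := Nat.succ_div (a := n) (b := p - 1)
        rw [if_pos hd] at this
        rw [← this, Nat.mul_div_cancel' hd]
      have h1 := h.norm_pow_mul_sub_one hp2 (n / (p - 1) + 1)
      rw [← e] at h1
      rw [h1, Nat.factorial_succ, Nat.cast_mul, norm_mul]
      ring
    · rw [h.norm_pow_sub_one_of_not_dvd hp2 hd, mul_one, add_zero]

/-- With $m=\lfloor n/(p-1)\rfloor$ the exponent of $|p|$ is $m+v_p(m!)$. Since $p-1\ge 2$,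
Legendre's formula bounds it by $n/2+n/4$; the fourth power avoids fractional exponents. -/
theorem norm_pow_le_prod_pow (h : GeneratesUnitsModSq p lam) (hp2 : p ≠ 2) (n : ℕ) :
    ‖(p : ℚ_[p])‖ ^ (3 * n) ≤ (∏ j ∈ Finset.range n, ‖lam ^ (j + 1) - 1‖) ^ 4 := by
  rw [h.prod_norm_pow_sub_one hp2, padic_norm_factorial, ← pow_add, ← pow_mul]
  refine pow_le_pow_of_le_one (norm_nonneg _) Padic.norm_p_lt_one.le ?_
  have h3 : 2 ≤ p - 1 := by
    have := hp.out.two_le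
    omega
  have h1 : (p - 1) * padicValNat p ((n / (p - 1)) !) ≤ n / (p - 1) := by
    rw [sub_one_mul_padicValNat_factorial]
    exact Nat.sub_le _ _
  have h2 := Nat.mul_div_le n (p - 1)
  have h4 := (Nat.mul_le_mul_right _ h3).trans h1
  have h5 := (Nat.mul_le_mul_right _ h3).trans h2
  omega

end GeneratesUnitsModSq

variable {F G : PowerSeries ℚ_[p]}

/-- The small divisors cost at most $|p|^{3n/4}$, while $ar\le|p|$ gains $|p|^n$. The surplus is
$\theta^n$ with $\theta=|p|^{1/4}$. -/
theorem IsFormalConjugacy.norm_coeff_mul_pow_le (hG : IsFormalConjugacy F G) (hp2 : p ≠ 2)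
    (hF0 : PowerSeries.coeff 0 F = 0) (hgen : GeneratesUnitsModSq p (PowerSeries.coeff 1 F))
    {a r θ : ℝ} (ha : 0 ≤ a) (hr : 0 ≤ r) (hF : ∀ n, ‖PowerSeries.coeff (n + 1) F‖ ≤ a ^ n)
    (har : a * r ≤ ‖(p : ℚ_[p])‖) (hθ0 : 0 < θ) (hθ : θ ^ 4 = ‖(p : ℚ_[p])‖) (n : ℕ) :
    ‖PowerSeries.coeff (n + 1) G‖ * r ^ n ≤ θ ^ n := by
  have h1 := hG.norm_coeff_mul_prod_le ha hF0 hgen.norm_eq_one hF n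
  have h2 : θ ^ (3 * n) ≤ ∏ j ∈ Finset.range n, ‖PowerSeries.coeff 1 F ^ (j + 1) - 1‖ := by
    refine le_of_pow_le_pow_left₀ four_ne_zero (Finset.prod_nonneg fun _ _ => norm_nonneg _) ?_
    rw [← pow_mul, mul_comm, pow_mul, hθ]
    exact hgen.norm_pow_le_prod_pow hp2 n
  refine le_of_mul_le_mul_right ?_ (pow_pos hθ0 (3 * n))
  calc ‖PowerSeries.coeff (n + 1) G‖ * r ^ n * θ ^ (3 * n)
      ≤ ‖PowerSeries.coeff (n + 1) G‖ * r ^ n *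
        ∏ j ∈ Finset.range n, ‖PowerSeries.coeff 1 F ^ (j + 1) - 1‖ := by gcongr
    _ = ‖PowerSeries.coeff (n + 1) G‖ *
        (∏ j ∈ Finset.range n, ‖PowerSeries.coeff 1 F ^ (j + 1) - 1‖) * r ^ n := by ring
    _ ≤ a ^ n * r ^ n := by gcongr
    _ = (a * r) ^ n := by rw [mul_pow]
    _ ≤ (θ ^ 4) ^ n := by rw [hθ]; gcongr
    _ = θ ^ n * θ ^ (3 * n) := by ring

variable {L : Type*} [NontriviallyNormedField L] [NormedAlgebra ℚ_[p] L] [IsUltrametricDist L]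
  [CompleteSpace L]

theorem IsFormalConjugacy.linearizesOn_closedBall (hG : IsFormalConjugacy F G) (hp2 : p ≠ 2)
    (hF0 : PowerSeries.coeff 0 F = 0) (hgen : GeneratesUnitsModSq p (PowerSeries.coeff 1 F))
    (hb : BddAbove (growthSet F)) {r : ℝ} (hr : 0 ≤ r) (har : growth F * r ≤ ‖(p : ℚ_[p])‖)
    (x₀ : L) : LinearizesOn F G x₀ (Metric.closedBall x₀ r) := by
  have hpp := padic_norm_prime_pos (p := p)
  have hp1 : ‖(p : ℚ_[p])‖ < 1 := Padic.norm_p_lt_one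
  obtain ⟨θ, hθ0, hθ⟩ : ∃ θ : ℝ, 0 < θ ∧ θ ^ 4 = ‖(p : ℚ_[p])‖ :=
    ⟨‖(p : ℚ_[p])‖ ^ ((4 : ℕ) : ℝ)⁻¹, by positivity,
      Real.rpow_inv_natCast_pow hpp.le four_ne_zero⟩
  have hθ1 : θ < 1 := by
    by_contra! hge
    exact (one_le_pow₀ hge (n := 4)).not_gt (hθ ▸ hp1)
  have hF := norm_coeff_le_growth_pow hb hgen.norm_eq_one
  refine hG.linearizesOn (growth_nonneg F) hr hθ0.le hθ1 (har.trans ?_) hF0 hF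
    (hG.norm_coeff_mul_pow_le hp2 hF0 hgen (growth_nonneg F) hr hF har hθ0 hθ) x₀
  rw [← hθ]
  exact pow_le_of_le_one hθ0.le hθ1.le four_ne_zero

theorem exists_isLinearizationDisc (hp2 : p ≠ 2) (hF0 : PowerSeries.coeff 0 F = 0)
    (hgen : GeneratesUnitsModSq p (PowerSeries.coeff 1 F)) (hb : BddAbove (growthSet F))
    (x₀ : ℚ_[p]) : ∃ Δ : Set L, IsLinearizationDisc F x₀ Δ := by
  have hpp := padic_norm_prime_pos (p := p)
  have ha := growth_nonneg F
  have hne : ∀ n : ℕ, 1 ≤ n → PowerSeries.coeff 1 F ^ n ≠ 1 := fun n hn =>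
    hgen.pow_ne_one hp2 (by omega)
  obtain ⟨G, hG⟩ := exists_isFormalConjugacy hF0
    (norm_pos_iff.1 (hgen.norm_eq_one ▸ one_pos)) hne
  -- Adding 1 in the denominator gives an admissible radius for $a=0$ as well.
  have hr : 0 < ‖(p : ℚ_[p])‖ / (growth F + 1) := by positivity
  obtain ⟨Δ, hΔ⟩ := exists_isGreatest_linearizesOn
    (Or.inr ⟨_, hr, Or.inr rfl⟩)
    (hG.linearizesOn_closedBall hp2 hF0 hgen hb hr.le (by
      rw [← mul_div_assoc, div_le_iff₀ (by positivity)]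
      nlinarith) (algebraMap ℚ_[p] L x₀))
  exact ⟨Δ, hF0, hgen.norm_eq_one, hne, G, hG, hΔ⟩

variable {x₀ : ℚ_[p]} {Δ : Set L}

theorem IsLinearizationDisc.mem_restrictDisc (h : IsLinearizationDisc F x₀ Δ) (hp2 : p ≠ 2)
    (hgen : GeneratesUnitsModSq p (PowerSeries.coeff 1 F)) (hb : BddAbove (growthSet F)) {r : ℝ}
    (hr : 0 < r) (har : growth F * r ≤ ‖(p : ℚ_[p])‖) {x : ℚ_[p]} (hx : dist x x₀ ≤ r) :
    x ∈ restrictDisc ℚ_[p] Δ := by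
  obtain ⟨G, hG, hgreat⟩ := h.greatest
  refine hgreat.2 ⟨Or.inr ⟨r, hr, Or.inr rfl⟩,
    hG.linearizesOn_closedBall hp2 h.coeff_zero hgen hb hr.le har _⟩ ?_
  rwa [Metric.mem_closedBall, (algebraMap_isometry ℚ_[p] L).dist_eq]

/-- If $a|x-x_0|>1$, some term of $f$ of degree at least 2 exceeds the linear term in norm at
$x-x_0$, which is impossible where $f$ is one-to-one over $L$. -/
theorem IsLinearizationDisc.growth_mul_le_one [IsAlgClosed L] (h : IsLinearizationDisc F x₀ Δ)
    {x : ℚ_[p]} (hx : x ∈ restrictDisc ℚ_[p] Δ) : growth F * dist x x₀ ≤ 1 := by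
  by_contra! hgt
  obtain ⟨G, hG, ⟨hdisc, hlin⟩, -⟩ := h.greatest
  have hd : 0 < dist x x₀ := dist_nonneg.lt_of_ne fun h0 => by
    rw [← h0, mul_zero] at hgt
    exact hgt.not_ge zero_le_one
  obtain ⟨n, hn⟩ := exists_one_lt_norm_coeff_mul_pow hd hgt
  have hsn : ‖algebraMap ℚ_[p] L (x - x₀)‖ = dist x x₀ := by rw [norm_algebraMap', dist_eq_norm]
  have hsub := hdisc.closedBall_subset hx
  rw [(algebraMap_isometry ℚ_[p] L).dist_eq] at hsub
  have hlt := norm_coeff_mul_pow_lt_one (s := algebraMap ℚ_[p] L (x - x₀))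
    (by rw [map_sub]; exact hlin.conv_f _ hx) (norm_pos_iff.1 (hsn ▸ hd)) h.coeff_zero
    h.indifferent (by rw [hsn]; exact (hlin.mono hsub).injOn_value_left h.indifferent) n
  rw [hsn] at hlt
  exact hlt.not_gt hn

theorem IsLinearizationDisc.restrictDisc_eq_univ (h : IsLinearizationDisc F x₀ Δ) (hp2 : p ≠ 2)
    (hgen : GeneratesUnitsModSq p (PowerSeries.coeff 1 F)) (hb : BddAbove (growthSet F))
    (h0 : growth F = 0) : restrictDisc ℚ_[p] Δ = Set.univ := by
  refine Set.eq_univ_of_forall fun x => ?_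
  refine h.mem_restrictDisc hp2 hgen hb (r := dist x x₀ + 1) (by positivity) ?_ (by linarith)
  rw [h0, zero_mul]
  exact norm_nonneg _

/-- In $\mathbb{Q}_p$ the open disc of radius $p^k$ is the closed disc of radius $p^{k-1}$, and
$ap^{k-1}\le 1/p$ puts it inside. The bound $a|x-x_0|\le 1$ confines the disc to radius below
$p^{k+1}$, hence to the closed disc of radius $p^k$. A single point on the sphere of radius $p^k$
brings in the whole closed disc. -/
theorem IsLinearizationDisc.restrictDisc_eq_ball_or_closedBall [IsAlgClosed L]
    (h : IsLinearizationDisc F x₀ Δ) (hp2 : p ≠ 2)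
    (hgen : GeneratesUnitsModSq p (PowerSeries.coeff 1 F)) (hb : BddAbove (growthSet F))
    (h0 : 0 < growth F) {k : ℤ} (hk : (p : ℝ) ^ k ≤ 1 / growth F)
    (hk1 : 1 / growth F < (p : ℝ) ^ (k + 1)) :
    restrictDisc ℚ_[p] Δ = Metric.ball x₀ ((p : ℝ) ^ k) ∨
      restrictDisc ℚ_[p] Δ = Metric.closedBall x₀ ((p : ℝ) ^ k) := by
  have hp0 : (0 : ℝ) < p := by exact_mod_cast hp.out.pos
  have hlow : Metric.ball x₀ ((p : ℝ) ^ k) ⊆ restrictDisc ℚ_[p] Δ := by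
    intro x hx
    refine h.mem_restrictDisc hp2 hgen hb (r := (p : ℝ) ^ (k - 1)) (by positivity) ?_ ?_
    · rw [le_div_iff₀ h0] at hk
      rw [zpow_sub_one₀ hp0.ne', Padic.norm_p, ← mul_assoc, mul_comm (growth F)]
      exact mul_le_of_le_one_left (by positivity) hk
    · rw [dist_eq_norm, Padic.norm_le_pow_iff_norm_lt_pow_add_one, sub_add_cancel, ← dist_eq_norm]
      exact hx
  have hup : restrictDisc ℚ_[p] Δ ⊆ Metric.closedBall x₀ ((p : ℝ) ^ k) := by
    intro x hx
    rw [Metric.mem_closedBall, dist_eq_norm, Padic.norm_le_pow_iff_norm_lt_pow_add_one,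
      ← dist_eq_norm]
    refine lt_of_le_of_lt ?_ hk1
    rw [le_div_iff₀ h0, mul_comm]
    exact h.growth_mul_le_one hx
  by_cases hatt : ∃ x ∈ restrictDisc ℚ_[p] Δ, dist x x₀ = (p : ℝ) ^ k
  · obtain ⟨x, hx, hxk⟩ := hatt
    refine Or.inr (hup.antisymm fun y hy => ?_)
    obtain ⟨G, hG, ⟨hdisc, -⟩, -⟩ := h.greatest
    refine hdisc.closedBall_subset hx ?_
    rw [Metric.mem_closedBall, (algebraMap_isometry ℚ_[p] L).dist_eq,
      (algebraMap_isometry ℚ_[p] L).dist_eq, hxk]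
    exact hy
  · push Not at hatt
    exact Or.inl (Set.Subset.antisymm (fun x hx => lt_of_le_of_ne (hup hx) (hatt x hx)) hlow)

end PadicRadius

end NonArch

end

theorem theoremJ :
    -- ergodic linearization spheres
    (∀ (K : Type*) [NontriviallyNormedField K] [IsUltrametricDist K] [CompleteSpace K]
        [MeasurableSpace K] [BorelSpace K]
        (L : Type*) [NontriviallyNormedField L] [IsUltrametricDist L] [CompleteSpace L]
        [IsAlgClosed L] [NormedAlgebra K L]
        (f : K → K) (x₀ : K) (F : PowerSeries K) (U : Set K) (Δ : Set L),
        NonArch.HolomorphicWithFixedPoint f x₀ F U →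
        NonArch.IsLinearizationDisc F x₀ Δ →
        NonArch.restrictDisc K Δ ⊆ U →
        ∀ r : ℝ, 0 < r → (Metric.sphere x₀ r).Nonempty →
          Metric.sphere x₀ r ⊆ NonArch.restrictDisc K Δ →
          ∃ hS : Set.MapsTo f (Metric.sphere x₀ r) (Metric.sphere x₀ r),
            List.TFAE
              [NonArch.IsErgodicForSome (hS.restrict f (Metric.sphere x₀ r) (Metric.sphere x₀ r)),
               NonArch.IsErgodicForAll (hS.restrict f (Metric.sphere x₀ r) (Metric.sphere x₀ r)),
               NonArch.IsPadicWithGenerator (PowerSeries.coeff 1 F)]) ∧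
    -- no transitive multiplier map over a proper finite extension of `ℚ_p`
    (∀ (p : ℕ) [Fact p.Prime] (K : Type*) [NontriviallyNormedField K] [IsUltrametricDist K]
        [NormedAlgebra ℚ_[p] K] [FiniteDimensional ℚ_[p] K],
        1 < Module.finrank ℚ_[p] K →
        ∀ lam : K, ‖lam‖ = 1 → ∀ r : ℝ, 0 < r →
          ¬ NonArch.IsTransitiveOn (fun x : K => lam * x) (Metric.sphere 0 r)) ∧
    -- no transitive multiplier map over a locally compact field of positive characteristic
    (∀ (p : ℕ) [Fact p.Prime] (K : Type*) [NontriviallyNormedField K] [IsUltrametricDist K]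
        [LocallyCompactSpace K] [CharP K p],
        ∀ lam : K, ‖lam‖ = 1 → ∀ r : ℝ, 0 < r →
          ¬ NonArch.IsTransitiveOn (fun x : K => lam * x) (Metric.sphere 0 r)) ∧
    -- the radius of the linearization disc over `ℚ_p`
    (∀ (p : ℕ) [Fact p.Prime], p ≠ 2 →
        ∀ (L : Type*) [NontriviallyNormedField L] [IsUltrametricDist L] [CompleteSpace L]
        [IsAlgClosed L] [NormedAlgebra ℚ_[p] L]
        (x₀ : ℚ_[p]) (F : PowerSeries ℚ_[p]),
        PowerSeries.coeff 0 F = 0 →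
        NonArch.GeneratesUnitsModSq p (PowerSeries.coeff 1 F) →
        BddAbove (NonArch.growthSet F) →
        (∃ Δ : Set L, NonArch.IsLinearizationDisc F x₀ Δ) ∧
        ∀ Δ : Set L, NonArch.IsLinearizationDisc F x₀ Δ →
          (NonArch.growth F = 0 → NonArch.restrictDisc ℚ_[p] Δ = Set.univ) ∧
          (0 < NonArch.growth F → ∀ k : ℤ,
            (p : ℝ) ^ k ≤ 1 / NonArch.growth F → 1 / NonArch.growth F < (p : ℝ) ^ (k + 1) →
            (NonArch.restrictDisc ℚ_[p] Δ = Metric.ball x₀ ((p : ℝ) ^ k) ∨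
              NonArch.restrictDisc ℚ_[p] Δ = Metric.closedBall x₀ ((p : ℝ) ^ k)))) := by
  refine ⟨?_, ?_, ?_, ?_⟩
  · intro K _ _ _ _ _ L _ _ _ _ _ f x₀ F U Δ hf hΔ hΔU r hr hne hsub
    exact NonArch.tfae_isErgodic hf hΔ hΔU hr hne hsub
  · intro p _ K _ _ _ _ hrank lam hlam r hr
    exact NonArch.not_isTransitiveOn_of_finiteDimensional p hrank hlam hr
  · intro p _ K _ _ _ _ lam hlam r hr
    exact NonArch.not_isTransitiveOn_of_charP p hlam hr
  · intro p _ hp2 L _ _ _ _ _ x₀ F hF0 hgen hb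
    exact ⟨NonArch.exists_isLinearizationDisc hp2 hF0 hgen hb x₀, fun Δ h =>
      ⟨h.restrictDisc_eq_univ hp2 hgen hb, fun h0 _ hk hk1 =>
        h.restrictDisc_eq_ball_or_closedBall hp2 hgen hb h0 hk hk1⟩⟩
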